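/- Let ${\bf e}_1,{\bf e}_2\in\mathbb{R}^2$ be linearly independent, and let $\Omega_1,\dots,\Omega_N\subset\mathbb{R}^2$ ($N\ge 0$) be bounded open sets, each with boundary $\Gamma_i=\partial\Omega_i$ a $C^\infty$ regular simple closed curve, such that the closed lattice translates $\overline{\Omega}_i+m_1{\bf e}_1+m_2{\bf e}_2$ ($1\le i\le N$, $m_1,m_2\in\mathbb{Z}$) are pairwise disjoint. Let $\Omega_\Lambda$ be the union of all the lattice translates of $\Omega_1,\dots,\Omega_N$. Let ${\bf x}_i^c=\frac{1}{|\Gamma_i|}\int_{\Gamma_i}{\bf x}\,ds$, let ${\bf n}$ be the unit normal on $\Gamma_i$ pointing out of $\Omega_i$, write ${\bf x}^\perp=(-x_2,x_1)$, and let $\mu>0$. For a velocity ${\bf u}$ and a pressure $p$ put $$\sigma_{ij}=-\delta_{ij}\,p+\mu\Big(\frac{\partial u_i}{\partial x_j}+\frac{\partial u_j}{\partial x_i}\Big),\qquad {\bf T}=\sigma{\bf n}.$$ Suppose that ${\bf u}$ is $C^2$ in $\mathbb{R}^2\setminus\overline{\Omega}_\Lambda$ and $C^1$ up to the boundary, that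 $p$ is $C^1$ in $\mathbb{R}^2\setminus\overline{\Omega}_\Lambda$ and continuous up to the boundary, and that $({\bf u},p)$ solves the periodic mobility boundary value problem with zero background flow, that is, for some ${\bf v}_i\in\mathbb{R}^2$ and $\omega_i\in\mathbb{R}$ ($1\le i\le N$), \begin{align*} -\mu\Delta{\bf u}+\nabla p&=0,\qquad \nabla\cdot{\bf u}=0 \qquad\text{in }\mathbb{R}^2\setminus\overline{\Omega}_\Lambda,\\ {\bf u}({\bf x})&={\bf v}_i+\omega_i({\bf x}-{\bf x}_i^c)^\perp\qquad({\bf x}\in\Gamma_i,\ 1\le i\le N),\\ \int_{\Gamma_i}{\bf T}\,ds&={\bf 0},\qquad \int_{\Gamma_i}\big({\bf T},({\bf x}-{\bf x}_i^c)^\perp\big)\,ds=0\qquad(1\le i\le N),\\ {\bf u}({\bf x}+m_1{\bf e}_1+m_2{\bf e}_2)&={\bf u}({\bf x}),\qquad p({\bf x}+m_1{\bf e}_1+m_2{\bf e}_2)=p({\bf x})\qquad(m_1,m_2\in\mathbb{Z}). \end{align*} Then ${\bf u}$ and $p$ are constant on $\mathbb{R}^2\setminus\Omega_\Lambda$, that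 is, in the fluid and on the boundaries of the objects. -/

import Mathlib

noncomputable section

namespace PeriodicMobility

/-- The Euclidean plane. -/
abbrev Plane : Type := EuclideanSpace ℝ (Fin 2)

/-- The rotation by a right angle, `(x₁, x₂) ↦ (-x₂, x₁)`. -/
def perp (x : Plane) : Plane := !₂[-x 1, x 0]

/-- A bounded smooth object in the plane: a bounded open set whose boundary is a smooth regular
simple closed curve, parametrized with period `2π` and positively oriented (the object lies to the
left of the direction of travel). -/
structure SmoothObject where
  /-- the (open) object -/
  body : Set Plane
  /-- the parametrization of its boundary -/
  curve : ℝ → Plane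
  isOpen_body : IsOpen body
  isBounded_body : Bornology.IsBounded body
  contDiff_curve : ContDiff ℝ (⊤ : ℕ∞) curve
  periodic_curve : Function.Periodic curve (2 * Real.pi)
  injOn_curve : Set.InjOn curve (Set.Ico 0 (2 * Real.pi))
  deriv_curve_ne_zero : ∀ t, deriv curve t ≠ 0
  frontier_body : frontier body = Set.range curve
  positively_oriented :
    ∀ t, ∀ᶠ s in nhdsWithin (0 : ℝ) (Set.Ioi 0), curve t + s • perp (deriv curve t) ∈ body

namespace SmoothObject

variable (B : SmoothObject)

/-- The integral with respect to arc length over the boundary of the object, of a function that is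
given in terms of the boundary parameter. -/
def boundaryIntegral {G : Type*} [NormedAddCommGroup G] [NormedSpace ℝ G] (f : ℝ → G) : G :=
  ∫ t in (0 : ℝ)..(2 * Real.pi), ‖deriv B.curve t‖ • f t

/-- The length of the boundary. -/
def perimeter : ℝ := B.boundaryIntegral fun _ => (1 : ℝ)

/-- The centroid, that is, the mean position over the boundary. -/
def centroid : Plane := B.perimeter⁻¹ • B.boundaryIntegral B.curve

/-- The unit normal vector at the boundary point with parameter `t` that points out of the
object (the unit tangent vector turned clockwise by a right angle). -/
def outwardNormal (t : ℝ) : Plane := -(‖deriv B.curve t‖⁻¹ • perp (deriv B.curve t))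

end SmoothObject

/-- The lattice vector `m₁ e₁ + m₂ e₂`. -/
def latticeVector (e₁ e₂ : Plane) (m₁ m₂ : ℤ) : Plane := (m₁ : ℝ) • e₁ + (m₂ : ℝ) • e₂

/-- A doubly periodic suspension with `N` objects per unit cell: two linearly independent lattice
vectors and `N` smooth objects, such that no two of the closed lattice translates of the objects
meet. The objects may cross the walls of any particular unit cell. -/
structure Suspension (N : ℕ) where
  e₁ : Plane
  e₂ : Plane
  linearIndependent : LinearIndependent ℝ ![e₁, e₂]
  object : Fin N → SmoothObject
  disjoint_translates : ∀ (i j : Fin N) (m₁ m₂ : ℤ), (i, m₁, m₂) ≠ (j, 0, 0) →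
    Disjoint ((fun x => x + latticeVector e₁ e₂ m₁ m₂) '' closure (object i).body)
      (closure (object j).body)

namespace Suspension

variable {N : ℕ} (S : Suspension N)

/-- The infinite lattice of (open) objects. -/
def solid : Set Plane :=
  {x | ∃ (j : Fin N) (m₁ m₂ : ℤ), x + latticeVector S.e₁ S.e₂ m₁ m₂ ∈ (S.object j).body}

/-- The open domain of the suspending fluid. -/
def fluid : Set Plane := (closure S.solid)ᶜ

/-- The fluid domain together with the boundaries of all the objects. -/
def closedFluid : Set Plane := S.solidᶜ

end Suspension

/-- The partial derivative `∂ uᵢ / ∂ xⱼ` at `x`, taken within the set `D` (it is the usual partial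
derivative at interior points, and the one-sided one at boundary points). -/
def partialWithin (D : Set Plane) (u : Plane → Plane) (x : Plane) (i j : Fin 2) : ℝ :=
  (fderivWithin ℝ u D x (EuclideanSpace.single j 1)) i

/-- The stress tensor `σᵢⱼ = -δᵢⱼ p + μ (∂ uᵢ / ∂ xⱼ + ∂ uⱼ / ∂ xᵢ)`. -/
def stress (μ : ℝ) (D : Set Plane) (u : Plane → Plane) (p : Plane → ℝ) (x : Plane) :
    Matrix (Fin 2) (Fin 2) ℝ :=
  Matrix.of fun i j =>
    -(if i = j then p x else 0) + μ * (partialWithin D u x i j + partialWithin D u x j i)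

/-- The traction `σ n` for the normal vector `n`. -/
def traction (μ : ℝ) (D : Set Plane) (u : Plane → Plane) (p : Plane → ℝ) (x n : Plane) : Plane :=
  WithLp.toLp 2 ((stress μ D u p x).mulVec n.ofLp)

/-- The traction at the point with parameter `t` of the boundary of the `i`-th object. -/
def Suspension.boundaryTraction {N : ℕ} (S : Suspension N) (μ : ℝ) (u : Plane → Plane)
    (p : Plane → ℝ) (i : Fin N) (t : ℝ) : Plane :=
  traction μ S.closedFluid u p ((S.object i).curve t) ((S.object i).outwardNormal t)

/-- `(u, p)`, with the linear velocities `v` and the angular velocities `ω` of the objects, is a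
classical solution of the periodic quasi-static mobility boundary value problem for the suspension
`S`, the viscosity `μ` and the background flow `u₀`. Only the values of `u` and `p` in the fluid and
on the boundaries of the objects play a role. -/
structure IsMobilitySolution {N : ℕ} (S : Suspension N) (μ : ℝ) (u₀ : Plane → Plane)
    (u : Plane → Plane) (p : Plane → ℝ) (v : Fin N → Plane) (ω : Fin N → ℝ) : Prop where
  contDiffOn_velocity : ContDiffOn ℝ 2 u S.fluid
  contDiffOn_velocity_closed : ContDiffOn ℝ 1 u S.closedFluid
  contDiffOn_pressure : ContDiffOn ℝ 1 p S.fluid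
  continuousOn_pressure_closed : ContinuousOn p S.closedFluid
  stokes : ∀ x ∈ S.fluid, -(μ • Laplacian.laplacian u x) + gradient p x = 0
  incompressible : ∀ x ∈ S.fluid, ∑ i, fderiv ℝ u x (EuclideanSpace.single i 1) i = 0
  rigid : ∀ i, ∀ x ∈ frontier (S.object i).body,
    u x + u₀ x = v i + ω i • perp (x - (S.object i).centroid)
  force_free : ∀ i, (S.object i).boundaryIntegral (S.boundaryTraction μ u p i) = 0
  torque_free : ∀ i, (S.object i).boundaryIntegral (fun t =>
    inner ℝ (S.boundaryTraction μ u p i t)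
      (perp ((S.object i).curve t - (S.object i).centroid))) = 0
  periodic_velocity : ∀ x ∈ S.closedFluid, ∀ m₁ m₂ : ℤ,
    u (x + latticeVector S.e₁ S.e₂ m₁ m₂) = u x
  periodic_pressure : ∀ x ∈ S.closedFluid, ∀ m₁ m₂ : ℤ,
    p (x + latticeVector S.e₁ S.e₂ m₁ m₂) = p x

end PeriodicMobility

end

/-!
The work `σ u` of the stress has divergence equal to the viscous dissipation. Its flux through the
boundary of an object that moves rigidly is the pairing of the motion with the resultant force and
torque, so it vanishes, and by periodicity nothing is transmitted through the walls of a unit cell.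
Hence the dissipation vanishes identically, the strain rate is zero, the second derivatives of `u`
vanish, and the pressure gradient with them. As the fluid domain is connected, `p` is constant and
`u` is affine, and an affine function with two independent periods is constant.

The divergence theorem is obtained without cutting the objects along the cell walls: the vector
field is multiplied by a periodic cutoff that depends only on the depth inside a tubular collar of
the boundary curves, and the width of the transition layer is sent to zero.
-/

noncomputable section

namespace PeriodicMobility

open Filter Topology MeasureTheory Set
open scoped Real Pointwise

/-- The `j`-th standard basis vector of the plane. -/
abbrev unitVec (j : Fin 2) : Plane := EuclideanSpace.single j 1

/-- The point of the plane with the given coordinates. -/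
def point (t s : ℝ) : Plane := !₂[t, s]

@[simp] lemma point_zero (t s : ℝ) : point t s 0 = t := by simp [point]

@[simp] lemma point_one (t s : ℝ) : point t s 1 = s := by simp [point]

@[simp] lemma point_coords (y : Plane) : point (y 0) (y 1) = y := by
  ext i; fin_cases i <;> simp [point]

lemma point_eq (t s : ℝ) : point t s = t • unitVec 0 + s • unitVec 1 := by
  ext i; fin_cases i <;> simp [unitVec]

@[fun_prop]
lemma continuous_point {X : Type*} [TopologicalSpace X] {f g : X → ℝ} (hf : Continuous f)
    (hg : Continuous g) : Continuous fun x => point (f x) (g x) := by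
  simp only [point_eq]; fun_prop

lemma eq_sum_unitVec (x : Plane) : x = x 0 • unitVec 0 + x 1 • unitVec 1 := by
  rw [← point_eq, point_coords]

lemma contDiff_apply (j : Fin 2) {n : WithTop ℕ∞} : ContDiff ℝ n fun y : Plane => y j :=
  (EuclideanSpace.proj j : Plane →L[ℝ] ℝ).contDiff

lemma inner_eq (a b : Plane) : inner ℝ a b = a 0 * b 0 + a 1 * b 1 := by
  simp [PiLp.inner_apply, Fin.sum_univ_two, mul_comm]

/-- The determinant of the matrix with columns `a` and `b`. -/
def det2 (a b : Plane) : ℝ := a 0 * b 1 - a 1 * b 0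

lemma det_eq_det2 (L : Plane →L[ℝ] Plane) : L.det = det2 (L (unitVec 0)) (L (unitVec 1)) := by
  rw [ContinuousLinearMap.det,
    ← LinearMap.det_toMatrix (EuclideanSpace.basisFun (Fin 2) ℝ).toBasis, Matrix.det_fin_two]
  simp only [LinearMap.toMatrix_apply, OrthonormalBasis.coe_toBasis, EuclideanSpace.basisFun_apply,
    ContinuousLinearMap.coe_coe, OrthonormalBasis.coe_toBasis_repr_apply,
    EuclideanSpace.basisFun_repr, det2, sub_right_inj]
  ring

lemma det2_mul_apply (l : Plane →L[ℝ] ℝ) (a b c : Plane) :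
    det2 a b * l c = l a * det2 c b + l b * det2 a c := by
  rw [eq_sum_unitVec a, eq_sum_unitVec b, eq_sum_unitVec c]
  simp only [det2, PiLp.add_apply, PiLp.smul_apply, PiLp.single_eq_same, smul_eq_mul, mul_one,
    ne_eq, zero_ne_one, not_false_eq_true, PiLp.single_eq_of_ne, mul_zero, add_zero, one_ne_zero,
    zero_add, map_add, map_smul]
  ring

@[simp] lemma perp_apply_zero (x : Plane) : perp x 0 = -x 1 := by simp [perp]

@[simp] lemma perp_apply_one (x : Plane) : perp x 1 = x 0 := by simp [perp]

/-- The rotation by a right angle as a continuous linear map. -/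
def perpCLM : Plane →L[ℝ] Plane :=
  LinearMap.toContinuousLinearMap
    { toFun := perp
      map_add' := fun x y => by ext i; fin_cases i <;> simp [add_comm]
      map_smul' := fun c x => by ext i; fin_cases i <;> simp }

@[simp] lemma perpCLM_apply (x : Plane) : perpCLM x = perp x := rfl

namespace SmoothObject

variable (B : SmoothObject)

lemma contDiff_deriv_curve : ContDiff ℝ (⊤ : ℕ∞) (deriv B.curve) :=
  (contDiff_infty_iff_deriv.1 B.contDiff_curve).2

lemma hasDerivAt_curve (t : ℝ) : HasDerivAt B.curve (deriv B.curve t) t :=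
  (B.contDiff_curve.differentiable (by simp) t).hasDerivAt

lemma hasDerivAt_deriv_curve (t : ℝ) :
    HasDerivAt (deriv B.curve) (deriv (deriv B.curve) t) t :=
  (B.contDiff_deriv_curve.differentiable (by simp) t).hasDerivAt

lemma periodic_deriv_curve : Function.Periodic (deriv B.curve) (2 * π) := fun t => by
  rw [← deriv_comp_add_const, funext B.periodic_curve]

lemma curve_mem_frontier (t : ℝ) : B.curve t ∈ frontier B.body := by
  rw [B.frontier_body]; exact mem_range_self t

lemma curve_mem_closure (t : ℝ) : B.curve t ∈ closure B.body :=
  frontier_subset_closure (B.curve_mem_frontier t)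

lemma curve_notMem_body (t : ℝ) : B.curve t ∉ B.body := by
  simpa [B.isOpen_body.interior_eq] using (B.curve_mem_frontier t).2

lemma exists_eq_curve {x : Plane} (hx : x ∈ closure B.body) (hx' : x ∉ B.body) :
    ∃ t, B.curve t = x := by
  have hfrontier : x ∈ frontier B.body := ⟨hx, by rwa [B.isOpen_body.interior_eq]⟩
  rwa [B.frontier_body] at hfrontier

lemma exists_eq_add_period {t t' : ℝ} (h : B.curve t = B.curve t') :
    ∃ k : ℤ, t' = t + k • (2 * π) := by
  have hmod : ∀ t, B.curve (toIcoMod Real.two_pi_pos 0 t) = B.curve t := fun t => by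
    rw [toIcoMod, B.periodic_curve.sub_zsmul_eq]
  have hmem : ∀ t, toIcoMod Real.two_pi_pos 0 t ∈ Ico 0 (2 * π) := fun t => by
    simpa using toIcoMod_mem_Ico Real.two_pi_pos 0 t
  have heq := B.injOn_curve (hmem t) (hmem t') (by rw [hmod, hmod, h])
  have ht := toIcoMod_add_toIcoDiv_zsmul Real.two_pi_pos 0 t
  have ht' := toIcoMod_add_toIcoDiv_zsmul Real.two_pi_pos 0 t'
  refine ⟨toIcoDiv Real.two_pi_pos 0 t' - toIcoDiv Real.two_pi_pos 0 t, ?_⟩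
  rw [sub_zsmul]
  linarith

/-- The map `(t, s) ↦ γ(t) - s γ'(t)^⊥`, where `γ` is the parametrization of the boundary. For small
`s` it is a parametrization of a neighbourhood of the boundary, and the points with `s > 0` lie
outside of the object. -/
def collarMap (y : Plane) : Plane := B.curve (y 0) - y 1 • perp (deriv B.curve (y 0))

@[simp] lemma collarMap_point_zero (t : ℝ) : B.collarMap (point t 0) = B.curve t := by
  simp [collarMap]

lemma contDiff_collarMap : ContDiff ℝ (⊤ : ℕ∞) B.collarMap :=
  (B.contDiff_curve.comp (contDiff_apply 0)).sub
    ((contDiff_apply 1).smul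
      (perpCLM.contDiff.comp (B.contDiff_deriv_curve.comp (contDiff_apply 0))))

@[fun_prop]
lemma continuous_collarMap : Continuous B.collarMap := B.contDiff_collarMap.continuous

lemma differentiable_collarMap : Differentiable ℝ B.collarMap :=
  B.contDiff_collarMap.differentiable (by simp)

lemma fderiv_collarMap_apply (y v : Plane) : fderiv ℝ B.collarMap y v =
    v 0 • (deriv B.curve (y 0) - y 1 • perp (deriv (deriv B.curve) (y 0))) -
      v 1 • perp (deriv B.curve (y 0)) := by
  have hcoord : ∀ j, HasFDerivAt (fun z : Plane => z j) (EuclideanSpace.proj j : Plane →L[ℝ] ℝ) y :=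
    fun j => (EuclideanSpace.proj j : Plane →L[ℝ] ℝ).hasFDerivAt
  have hcurve := (B.hasDerivAt_curve (y 0)).hasFDerivAt.comp y (hcoord 0)
  have hnormal := perpCLM.hasFDerivAt.comp y
    ((B.hasDerivAt_deriv_curve (y 0)).hasFDerivAt.comp y (hcoord 0))
  have h : HasFDerivAt B.collarMap _ y := hcurve.sub ((hcoord 1).smul hnormal)
  rw [h.fderiv]
  ext i
  fin_cases i <;> simp <;> ring

/-- The Jacobian determinant of the collar map. -/
def collarJacobian (y : Plane) : ℝ := (fderiv ℝ B.collarMap y).det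

lemma collarJacobian_eq (y : Plane) : B.collarJacobian y =
    y 1 * det2 (deriv (deriv B.curve) (y 0)) (deriv B.curve (y 0)) -
      ‖deriv B.curve (y 0)‖ ^ 2 := by
  rw [collarJacobian, det_eq_det2, fderiv_collarMap_apply, fderiv_collarMap_apply,
    ← real_inner_self_eq_norm_sq, inner_eq]
  simp only [det2, PiLp.single_eq_same, one_smul, ne_eq, one_ne_zero, not_false_eq_true,
    PiLp.single_eq_of_ne, zero_smul, sub_zero, PiLp.sub_apply, PiLp.smul_apply, perp_apply_zero,
    smul_eq_mul, mul_neg, sub_neg_eq_add, zero_ne_one, zero_sub, PiLp.neg_apply, perp_apply_one,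
    neg_neg]
  ring

lemma continuous_collarJacobian : Continuous B.collarJacobian := by
  have h₁ : Continuous (deriv B.curve) := B.contDiff_deriv_curve.continuous
  have h₂ : Continuous (deriv (deriv B.curve)) :=
    (contDiff_infty_iff_deriv.1 B.contDiff_deriv_curve).2.continuous
  rw [funext B.collarJacobian_eq]
  unfold det2
  fun_prop

lemma collarJacobian_neg_of_eq_zero {y : Plane} (hy : y 1 = 0) : B.collarJacobian y < 0 := by
  have hspeed : 0 < ‖deriv B.curve (y 0)‖ := norm_pos_iff.2 (B.deriv_curve_ne_zero _)
  rw [collarJacobian_eq, hy, zero_mul, zero_sub, neg_lt_zero]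
  positivity

lemma exists_localInverse_collarMap {y : Plane} (hy : B.collarJacobian y ≠ 0) :
    ∃ e : OpenPartialHomeomorph Plane Plane, y ∈ e.source ∧ ⇑e = B.collarMap ∧
      ContDiffAt ℝ (⊤ : ℕ∞) e.symm (B.collarMap y) := by
  let A : Plane ≃L[ℝ] Plane := (fderiv ℝ B.collarMap y).toContinuousLinearEquivOfDetNeZero hy
  have hA : HasFDerivAt B.collarMap (A : Plane →L[ℝ] Plane) y := by
    have h := (B.differentiable_collarMap y).hasFDerivAt
    rwa [← ContinuousLinearMap.coe_toContinuousLinearEquivOfDetNeZero _ hy] at h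
  have hB : ContDiffAt ℝ (⊤ : ℕ∞) B.collarMap y := B.contDiff_collarMap.contDiffAt
  exact ⟨hB.toOpenPartialHomeomorph B.collarMap hA (by simp),
    hB.mem_toOpenPartialHomeomorph_source hA (by simp),
    hB.toOpenPartialHomeomorph_coe hA (by simp), hB.to_localInverse hA (by simp)⟩

lemma exists_injOn_collarMap {y : Plane} (hy : B.collarJacobian y ≠ 0) :
    ∃ U ∈ 𝓝 y, InjOn B.collarMap U := by
  obtain ⟨e, he, hcoe, -⟩ := B.exists_localInverse_collarMap hy
  exact ⟨e.source, e.open_source.mem_nhds he, hcoe ▸ e.injOn⟩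

lemma collarMap_image_mem_nhds {y : Plane} (hy : B.collarJacobian y ≠ 0) {U : Set Plane}
    (hU : U ∈ 𝓝 y) : B.collarMap '' U ∈ 𝓝 (B.collarMap y) := by
  obtain ⟨e, he, hcoe, -⟩ := B.exists_localInverse_collarMap hy
  exact hcoe ▸ e.image_mem_nhds he hU

end SmoothObject

/-- The period of the collar maps. -/
def collarPeriod : Plane := point (2 * π) 0

@[simp] lemma collarPeriod_zero : collarPeriod 0 = 2 * π := point_zero _ _

@[simp] lemma collarPeriod_one : collarPeriod 1 = 0 := point_one _ _

lemma exists_eq_point_add_period (y : Plane) :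
    ∃ t ∈ Ico 0 (2 * π), ∃ k : ℤ, y = point t (y 1) + k • collarPeriod := by
  refine ⟨toIcoMod Real.two_pi_pos 0 (y 0), by simpa using toIcoMod_mem_Ico Real.two_pi_pos 0 (y 0),
    toIcoDiv Real.two_pi_pos 0 (y 0), ?_⟩
  ext i
  fin_cases i <;> simp

namespace SmoothObject

variable (B : SmoothObject)

lemma periodic_collarMap : Function.Periodic B.collarMap collarPeriod := fun y => by
  simp [collarMap, B.periodic_curve (y 0), B.periodic_deriv_curve (y 0)]

lemma periodic_collarJacobian : Function.Periodic B.collarJacobian collarPeriod := fun y => by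
  rw [collarJacobian, ← fderiv_comp_add_right, funext B.periodic_collarMap, collarJacobian]

end SmoothObject

namespace Suspension

variable {N : ℕ} (S : Suspension N)

/-- The basis of the plane that consists of the two lattice vectors. -/
def basis : Module.Basis (Fin 2) ℝ Plane :=
  basisOfLinearIndependentOfCardEqFinrank S.linearIndependent (by simp)

@[simp] lemma basis_zero : S.basis 0 = S.e₁ := by simp [basis]

@[simp] lemma basis_one : S.basis 1 = S.e₂ := by simp [basis]

/-- The lattice of the periods of the suspension. -/
abbrev lattice : Submodule ℤ Plane := Submodule.span ℤ (range S.basis)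

variable {S}

lemma mem_lattice {a : Plane} :
    a ∈ S.lattice ↔ ∃ m₁ m₂ : ℤ, latticeVector S.e₁ S.e₂ m₁ m₂ = a := by
  rw [Submodule.mem_span_range_iff_exists_fun]
  simp only [Fin.sum_univ_two, basis_zero, basis_one, latticeVector, Int.cast_smul_eq_zsmul]
  exact ⟨fun ⟨c, hc⟩ => ⟨c 0, c 1, hc⟩, fun ⟨m₁, m₂, h⟩ => ⟨![m₁, m₂], h⟩⟩

lemma latticeVector_eq_zero {m₁ m₂ : ℤ} :
    latticeVector S.e₁ S.e₂ m₁ m₂ = 0 ↔ m₁ = 0 ∧ m₂ = 0 := by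
  refine ⟨fun h => ?_, fun ⟨h₁, h₂⟩ => by simp [h₁, h₂, latticeVector]⟩
  simpa using LinearIndependent.pair_iff.1 S.linearIndependent m₁ m₂ h

lemma mem_solid {x : Plane} :
    x ∈ S.solid ↔ ∃ (j : Fin N) (ℓ : S.lattice), x + ℓ ∈ (S.object j).body := by
  simp only [solid, mem_ofPred_eq, Subtype.exists, mem_lattice]
  grind

lemma finite_lattice_inter {K : Set Plane} (hK : Bornology.IsBounded K) :
    {ℓ : S.lattice | (ℓ : Plane) ∈ K}.Finite := by
  have h := (ZSpan.setFinite_inter S.basis hK).preimage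
    (Subtype.val_injective (p := (· ∈ S.lattice))).injOn
  exact h.subset fun ℓ hℓ => ⟨hℓ, ℓ.2⟩

lemma eq_of_mem_closure {x : Plane} {i j : Fin N} {ℓ ℓ' : S.lattice}
    (h : x + ℓ ∈ closure (S.object i).body) (h' : x + ℓ' ∈ closure (S.object j).body) :
    i = j ∧ ℓ = ℓ' := by
  obtain ⟨m₁, m₂, hm⟩ := mem_lattice.1 (ℓ' - ℓ).2
  by_contra hne
  refine disjoint_left.1 (S.disjoint_translates i j m₁ m₂ fun heq => hne ?_) ⟨_, h, ?_⟩ h'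
  · simp only [Prod.mk.injEq] at heq
    rw [latticeVector_eq_zero.2 heq.2, eq_comm, ZeroMemClass.coe_eq_zero, sub_eq_zero] at hm
    exact ⟨heq.1, hm.symm⟩
  · simp [hm]

lemma locallyFinite_translates {K : Fin N → Set Plane} (hK : ∀ i, Bornology.IsBounded (K i)) :
    LocallyFinite fun q : Fin N × S.lattice => {x | x + (q.2 : Plane) ∈ K q.1} := fun x => by
  have hbdd : Bornology.IsBounded ((⋃ i, K i) - Metric.ball x 1) :=
    (Bornology.isBounded_iUnion.2 hK).sub Metric.isBounded_ball
  refine ⟨Metric.ball x 1, Metric.ball_mem_nhds x one_pos,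
    (finite_univ.prod (finite_lattice_inter hbdd)).subset ?_⟩
  rintro ⟨i, ℓ⟩ ⟨z, hz, hzx⟩
  exact ⟨mem_univ _, z + ℓ, mem_iUnion.2 ⟨i, hz⟩, z, hzx, add_sub_cancel_left _ _⟩

lemma solid_eq_iUnion :
    S.solid = ⋃ q : Fin N × S.lattice, {x | x + (q.2 : Plane) ∈ (S.object q.1).body} := by
  ext x; simp [mem_solid]

lemma isOpen_solid : IsOpen S.solid := by
  rw [solid_eq_iUnion]
  exact isOpen_iUnion fun q => (S.object q.1).isOpen_body.preimage (continuous_add_const _)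

lemma mem_closure_solid {x : Plane} :
    x ∈ closure S.solid ↔ ∃ (j : Fin N) (ℓ : S.lattice), x + ℓ ∈ closure (S.object j).body := by
  have hclosure (q : Fin N × S.lattice) : closure {x | x + (q.2 : Plane) ∈ (S.object q.1).body} =
      {x | x + (q.2 : Plane) ∈ closure (S.object q.1).body} :=
    ((Homeomorph.addRight (q.2 : Plane)).preimage_closure (S.object q.1).body).symm
  rw [solid_eq_iUnion,
    (locallyFinite_translates fun i => (S.object i).isBounded_body).closure_iUnion]
  simp [hclosure]

lemma mem_fluid {x : Plane} :
    x ∈ S.fluid ↔ ∀ (j : Fin N) (ℓ : S.lattice), x + ℓ ∉ closure (S.object j).body := by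
  simp [fluid, mem_closure_solid]

lemma isOpen_fluid : IsOpen S.fluid := isClosed_closure.isOpen_compl

lemma fluid_subset_closedFluid : S.fluid ⊆ S.closedFluid := compl_subset_compl.2 subset_closure

lemma add_mem_solid (ℓ : S.lattice) {x : Plane} : x + ℓ ∈ S.solid ↔ x ∈ S.solid := by
  simp only [mem_solid]
  refine exists_congr fun j => ⟨fun ⟨m, h⟩ => ⟨ℓ + m, ?_⟩, fun ⟨m, h⟩ => ⟨m - ℓ, ?_⟩⟩
  · simpa [add_assoc] using h
  · simpa [add_assoc] using h

lemma add_mem_closedFluid (ℓ : S.lattice) {x : Plane} :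
    x + ℓ ∈ S.closedFluid ↔ x ∈ S.closedFluid := not_congr (add_mem_solid ℓ)

lemma add_mem_fluid (ℓ : S.lattice) {x : Plane} : x + ℓ ∈ S.fluid ↔ x ∈ S.fluid := by
  simp only [mem_fluid]
  refine forall_congr' fun j => ⟨fun h m => ?_, fun h m => ?_⟩
  · simpa [add_assoc] using h (m - ℓ)
  · simpa [add_assoc] using h (ℓ + m)

lemma exists_curve_eq_add {x : Plane} (hx : x ∈ S.closedFluid) (hx' : x ∉ S.fluid) :
    ∃ (i : Fin N) (ℓ : S.lattice) (t : ℝ), (S.object i).curve t = x + ℓ := by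
  obtain ⟨i, ℓ, h⟩ := mem_closure_solid.1 (not_not.1 hx')
  exact ⟨i, ℓ, (S.object i).exists_eq_curve h fun hb => hx (mem_solid.2 ⟨i, ℓ, hb⟩)⟩

lemma curve_mem_closedFluid (i : Fin N) (t : ℝ) : (S.object i).curve t ∈ S.closedFluid := by
  intro h
  obtain ⟨j, ℓ, h⟩ := mem_solid.1 h
  have h₀ : (S.object i).curve t + (0 : S.lattice) ∈ closure (S.object i).body := by
    simpa using (S.object i).curve_mem_closure t
  obtain ⟨rfl, rfl⟩ := eq_of_mem_closure h₀ (subset_closure h)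
  exact (S.object i).curve_notMem_body t (by simpa using h)

end Suspension

lemma eventually_forall_strip {P : Plane → Plane → Prop}
    (hP : ∀ t t', ∀ᶠ q in 𝓝 (point t 0, point t' 0), P q.1 q.2)
    (hper : ∀ y z (k l : ℤ), P y z → P (y + k • collarPeriod) (z + l • collarPeriod)) :
    ∀ᶠ δ in 𝓝[>] (0 : ℝ), ∀ y z : Plane, |y 1| < δ → |z 1| < δ → P y z := by
  have hK : IsCompact (Icc 0 (2 * π) ×ˢ Icc 0 (2 * π)) := isCompact_Icc.prod isCompact_Icc
  have hcont : Continuous fun q : (ℝ × ℝ) × ℝ × ℝ => (point q.2.1 q.1.1, point q.2.2 q.1.2) :=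
    by fun_prop
  have hcompact := hK.eventually_forall_of_forall_eventually (x₀ := ((0, 0) : ℝ × ℝ))
    (P := fun s t => P (point t.1 s.1) (point t.2 s.2))
    fun t _ => hcont.continuousAt.eventually (p := fun q => P q.1 q.2) (hP t.1 t.2)
  obtain ⟨ε, hε, hball⟩ := Metric.eventually_nhds_iff.1 hcompact
  filter_upwards [Ioo_mem_nhdsGT hε] with δ hδ y z hy hz
  obtain ⟨t, ht, k, hk⟩ := exists_eq_point_add_period y
  obtain ⟨t', ht', l, hl⟩ := exists_eq_point_add_period z
  rw [hk, hl]
  refine hper _ _ _ _ (hball (y := (y 1, z 1)) ?_ (t, t')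
    ⟨Ico_subset_Icc_self ht, Ico_subset_Icc_self ht'⟩)
  simp [Prod.dist_eq, hy.trans hδ.2, hz.trans hδ.2]

lemma SmoothObject.eventually_eq_add_period (B : SmoothObject) {t t' : ℝ}
    (h : B.curve t = B.curve t') :
    ∀ᶠ q in 𝓝 (point t 0, point t' 0), B.collarMap q.1 = B.collarMap q.2 →
      ∃ k : ℤ, q.2 = q.1 + k • collarPeriod := by
  obtain ⟨k, hk⟩ := B.exists_eq_add_period h
  have hpoint : point t 0 + k • collarPeriod = point t' 0 := by
    ext i; fin_cases i <;> simp [hk]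
  obtain ⟨U, hU, hinj⟩ := B.exists_injOn_collarMap
    (y := point t' 0) (B.collarJacobian_neg_of_eq_zero (by simp)).ne
  have hfst : ∀ᶠ q : Plane × Plane in 𝓝 (point t 0, point t' 0), q.1 + k • collarPeriod ∈ U :=
    (by fun_prop : Continuous fun q : Plane × Plane =>
      q.1 + k • collarPeriod).continuousAt.eventually_mem (by rwa [hpoint])
  have hsnd : ∀ᶠ q : Plane × Plane in 𝓝 (point t 0, point t' 0), q.2 ∈ U :=
    continuous_snd.continuousAt.eventually_mem hU
  filter_upwards [hfst, hsnd] with q h₁ h₂ heq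
  exact ⟨k, (hinj h₁ h₂ (by rw [← heq, B.periodic_collarMap.zsmul])).symm⟩

namespace Suspension

variable {N : ℕ} (S : Suspension N)

/-- `δ` is a width for which the collars of all the objects and of their translates are embedded
and pairwise disjoint. -/
structure IsCollarWidth (δ : ℝ) : Prop where
  pos : 0 < δ
  jacobian_neg (i : Fin N) (y : Plane) : |y 1| < δ → (S.object i).collarJacobian y < 0
  injective {i j : Fin N} {ℓ : S.lattice} {y z : Plane} : |y 1| < δ → |z 1| < δ →
    (S.object i).collarMap y + ℓ = (S.object j).collarMap z →
      i = j ∧ ℓ = 0 ∧ ∃ k : ℤ, z = y + k • collarPeriod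

variable {S}

lemma eq_of_curve_add_eq {i j : Fin N} {ℓ : S.lattice} {t t' : ℝ}
    (h : (S.object i).curve t + ℓ = (S.object j).curve t') : i = j ∧ ℓ = 0 := by
  have hj : (S.object i).curve t + ℓ ∈ closure (S.object j).body :=
    h ▸ (S.object j).curve_mem_closure t'
  have hi : (S.object i).curve t + (0 : S.lattice) ∈ closure (S.object i).body := by
    simpa using (S.object i).curve_mem_closure t
  obtain ⟨h₁, h₂⟩ := eq_of_mem_closure hi hj
  exact ⟨h₁, h₂.symm⟩

lemma eventually_collarMap_injective (i j : Fin N) (ℓ : S.lattice) :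
    ∀ᶠ δ in 𝓝[>] (0 : ℝ), ∀ y z : Plane, |y 1| < δ → |z 1| < δ →
      (S.object i).collarMap y + ℓ = (S.object j).collarMap z →
        i = j ∧ ℓ = 0 ∧ ∃ k : ℤ, z = y + k • collarPeriod := by
  refine eventually_forall_strip (P := fun y z => (S.object i).collarMap y + ℓ =
    (S.object j).collarMap z → i = j ∧ ℓ = 0 ∧ ∃ k : ℤ, z = y + k • collarPeriod)
    (fun t t' => ?_) fun y z k l hyz h => ?_
  · by_cases h : (S.object i).curve t + ℓ = (S.object j).curve t'
    · obtain ⟨rfl, rfl⟩ := eq_of_curve_add_eq h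
      filter_upwards [(S.object i).eventually_eq_add_period (by simpa using h)] with q hq heq
      exact ⟨rfl, rfl, hq (by simpa using heq)⟩
    · have hopen : IsOpen {q : Plane × Plane |
          (S.object i).collarMap q.1 + ℓ ≠ (S.object j).collarMap q.2} :=
        isOpen_ne_fun (by fun_prop) (by fun_prop)
      filter_upwards [hopen.mem_nhds (by simpa using h)] with q hq heq using absurd heq hq
  · rw [(S.object i).periodic_collarMap.zsmul, (S.object j).periodic_collarMap.zsmul] at h
    obtain ⟨hij, hℓ, m, rfl⟩ := hyz h
    exact ⟨hij, hℓ, m + l - k, by simp only [add_zsmul, sub_zsmul]; abel⟩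

lemma eventually_collarJacobian_neg (i : Fin N) :
    ∀ᶠ δ in 𝓝[>] (0 : ℝ), ∀ y : Plane, |y 1| < δ → (S.object i).collarJacobian y < 0 := by
  have hstrip := eventually_forall_strip (P := fun y _ => (S.object i).collarJacobian y < 0)
    (fun t t' => ((S.object i).continuous_collarJacobian.comp
      continuous_fst).continuousAt.eventually_lt continuousAt_const
        ((S.object i).collarJacobian_neg_of_eq_zero (by simp)))
    fun y _ k _ h => by rwa [(S.object i).periodic_collarJacobian.zsmul]
  filter_upwards [hstrip] with δ h y hy using h y y hy hy

lemma isBounded_collar (i : Fin N) :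
    Bornology.IsBounded ((S.object i).collarMap '' {y | |y 1| ≤ 1}) := by
  have hcompact : IsCompact ((fun q : ℝ × ℝ => (S.object i).collarMap (point q.1 q.2)) ''
      Icc 0 (2 * π) ×ˢ Icc (-1) 1) :=
    (isCompact_Icc.prod isCompact_Icc).image (by fun_prop)
  refine hcompact.isBounded.subset ?_
  rintro _ ⟨y, hy, rfl⟩
  obtain ⟨t, ht, k, hk⟩ := exists_eq_point_add_period y
  rw [hk, (S.object i).periodic_collarMap.zsmul]
  exact ⟨(t, y 1), ⟨Ico_subset_Icc_self ht, abs_le.1 hy⟩, rfl⟩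

lemma exists_isCollarWidth (S : Suspension N) : ∃ δ, S.IsCollarWidth δ := by
  let collars : Set Plane := ⋃ i, (S.object i).collarMap '' {y | |y 1| ≤ 1}
  have hcollars : Bornology.IsBounded collars := Bornology.isBounded_iUnion.2 isBounded_collar
  have hinj := (eventually_all_finite (finite_lattice_inter (S := S) (hcollars.sub hcollars))).2
    fun ℓ _ => eventually_all.2 fun i => eventually_all.2 fun j =>
      eventually_collarMap_injective i j ℓ
  have hjac := eventually_all.2 (eventually_collarJacobian_neg (S := S))
  have hone : ∀ᶠ δ in 𝓝[>] (0 : ℝ), δ ∈ Ioo 0 1 := Ioo_mem_nhdsGT one_pos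
  obtain ⟨δ, hinj, hjac, hδ⟩ := (hinj.and (hjac.and hone)).exists
  refine ⟨δ, hδ.1, hjac, fun {i j ℓ y z} hy hz h => hinj ℓ ?_ i j y z hy hz h⟩
  exact ⟨_, mem_iUnion.2 ⟨j, z, (hz.trans hδ.2).le, rfl⟩, _,
    mem_iUnion.2 ⟨i, y, (hy.trans hδ.2).le, rfl⟩, sub_eq_of_eq_add' h.symm⟩

end Suspension

lemma subset_of_isPreconnected_of_disjoint_frontier {X : Type*} [TopologicalSpace X] {A U : Set X}
    (hA : IsPreconnected A) (hU : IsOpen U) (hAU : (A ∩ U).Nonempty)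
    (hfrontier : Disjoint A (frontier U)) : A ⊆ U := by
  refine hA.subset_left_of_subset_union hU isClosed_closure.isOpen_compl
    (disjoint_compl_right_iff_subset.2 subset_closure) (fun x hx => ?_) hAU
  by_contra! h
  simp only [mem_union, mem_compl_iff, not_or, not_not] at h
  exact disjoint_left.1 hfrontier hx ⟨h.2, by rw [hU.interior_eq]; exact h.1⟩

/-- The strip of all points whose second coordinate lies in `I`. -/
def strip (I : Set ℝ) : Set Plane := (EuclideanSpace.proj 1 : Plane →L[ℝ] ℝ) ⁻¹' I

@[simp] lemma mem_strip {I : Set ℝ} {y : Plane} : y ∈ strip I ↔ y 1 ∈ I := Iff.rfl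

lemma convex_strip {I : Set ℝ} (hI : Convex ℝ I) : Convex ℝ (strip I) :=
  hI.linear_preimage (EuclideanSpace.proj 1 : Plane →L[ℝ] ℝ).toLinearMap

lemma isOpen_strip {I : Set ℝ} (hI : IsOpen I) : IsOpen (strip I) :=
  hI.preimage (EuclideanSpace.proj 1 : Plane →L[ℝ] ℝ).continuous

namespace Suspension.IsCollarWidth

variable {N : ℕ} {S : Suspension N} {δ : ℝ}

lemma collarMap_mem_body_iff (hδ : S.IsCollarWidth δ) {i j : Fin N} {ℓ : S.lattice} {I : Set ℝ}
    (hI : Convex ℝ I) (hIδ : I ⊆ Ioo (-δ) δ) (h₀ : 0 ∈ I → (i, ℓ) ≠ (j, 0)) {y z : Plane}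
    (hy : y 1 ∈ I) (hz : z 1 ∈ I) :
    (S.object i).collarMap y + ℓ ∈ (S.object j).body ↔
      (S.object i).collarMap z + ℓ ∈ (S.object j).body := by
  have hA : IsPreconnected ((fun y => (S.object i).collarMap y + (ℓ : Plane)) '' strip I) :=
    (convex_strip hI).isPreconnected.image _ (by fun_prop)
  have hfrontier : Disjoint ((fun y => (S.object i).collarMap y + (ℓ : Plane)) '' strip I)
      (frontier (S.object j).body) := by
    rw [(S.object j).frontier_body, disjoint_left]
    rintro _ ⟨w, hw, rfl⟩ ⟨t, ht⟩
    rw [← SmoothObject.collarMap_point_zero] at ht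
    obtain ⟨hij, hℓ, k, hk⟩ :=
      hδ.injective (abs_lt.2 (hIδ hw)) (by simpa using hδ.pos) ht.symm
    have hw₀ : w 1 = 0 := by simpa using (congrArg (· 1) hk).symm
    exact h₀ (hw₀ ▸ hw) (by rw [hij, hℓ])
  have hsubset {y z : Plane} (hy : y 1 ∈ I) (hz : z 1 ∈ I)
      (h : (S.object i).collarMap y + ℓ ∈ (S.object j).body) :
      (S.object i).collarMap z + ℓ ∈ (S.object j).body :=
    subset_of_isPreconnected_of_disjoint_frontier hA (S.object j).isOpen_body
      ⟨_, ⟨y, hy, rfl⟩, h⟩ hfrontier ⟨z, hz, rfl⟩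
  exact ⟨hsubset hy hz, hsubset hz hy⟩

lemma collarMap_mem_body (hδ : S.IsCollarWidth δ) (i : Fin N) {y : Plane}
    (hy : y 1 ∈ Ioo (-δ) 0) : (S.object i).collarMap y ∈ (S.object i).body := by
  have hsmall : ∀ᶠ s in 𝓝[>] (0 : ℝ), s ∈ Ioo 0 δ := Ioo_mem_nhdsGT hδ.pos
  obtain ⟨s, hs, hbody⟩ := (hsmall.and ((S.object i).positively_oriented 0)).exists
  have h := hδ.collarMap_mem_body_iff (i := i) (j := i) (ℓ := 0) (convex_Ioo (-δ) 0)
    (Ioo_subset_Ioo_right hδ.pos.le) (fun h => absurd h.2 (lt_irrefl 0)) hy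
    (z := point 0 (-s)) (by simpa using hs.symm)
  simpa [SmoothObject.collarMap, hbody] using h

lemma collarMap_image_strip_mem_nhds (hδ : S.IsCollarWidth δ) (i : Fin N) {y : Plane}
    (hy : y 1 ∈ Ioo (-δ) δ) :
    (S.object i).collarMap '' strip (Ioo (-δ) δ) ∈ 𝓝 ((S.object i).collarMap y) :=
  (S.object i).collarMap_image_mem_nhds (hδ.jacobian_neg i y (abs_lt.2 hy)).ne
    ((isOpen_strip isOpen_Ioo).mem_nhds hy)

lemma isOpen_collar (hδ : S.IsCollarWidth δ) (i : Fin N) :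
    IsOpen ((S.object i).collarMap '' strip (Ioo (-δ) δ)) :=
  isOpen_iff_mem_nhds.2 <| by
    rintro _ ⟨y, hy, rfl⟩
    exact hδ.collarMap_image_strip_mem_nhds i hy

lemma curve_mem_collar (hδ : S.IsCollarWidth δ) (i : Fin N) (t : ℝ) :
    (S.object i).curve t ∈ (S.object i).collarMap '' strip (Ioo (-δ) δ) :=
  ⟨point t 0, by simp [hδ.pos], SmoothObject.collarMap_point_zero _ _⟩

lemma collarMap_mem_closure (hδ : S.IsCollarWidth δ) (i : Fin N) {y : Plane}
    (hy : y 1 ∈ Ioc (-δ) 0) : (S.object i).collarMap y ∈ closure (S.object i).body := by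
  rcases hy.2.lt_or_eq with h | h
  · exact subset_closure (hδ.collarMap_mem_body i ⟨hy.1, h⟩)
  · rw [← point_coords y, h, SmoothObject.collarMap_point_zero]
    exact (S.object i).curve_mem_closure _

lemma collarMap_notMem_body (hδ : S.IsCollarWidth δ) (i : Fin N) {y : Plane}
    (hy : y 1 ∈ Ioo 0 δ) : (S.object i).collarMap y ∉ (S.object i).body := by
  intro hbody
  have houter {z : Plane} (hz : z 1 ∈ Ioo 0 δ) : (S.object i).collarMap z ∈ (S.object i).body := by
    have h := hδ.collarMap_mem_body_iff (i := i) (j := i) (ℓ := 0) (convex_Ioo 0 δ)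
      (Ioo_subset_Ioo_left (neg_nonpos.2 hδ.pos.le)) (fun h => absurd h.1 (lt_irrefl 0)) hy hz
    simpa [hbody] using h
  have hcollar : (S.object i).collarMap '' strip (Ioo (-δ) δ) ⊆ closure (S.object i).body := by
    rintro _ ⟨z, hz, rfl⟩
    rcases le_or_gt (z 1) 0 with h | h
    · exact hδ.collarMap_mem_closure i ⟨hz.1, h⟩
    · exact subset_closure (houter ⟨h, hz.2⟩)
  have hopen : IsOpen (closure (S.object i).body) := isOpen_iff_mem_nhds.2 fun x hx => by
    by_cases hxb : x ∈ (S.object i).body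
    · exact mem_of_superset ((S.object i).isOpen_body.mem_nhds hxb) subset_closure
    · obtain ⟨t, rfl⟩ := (S.object i).exists_eq_curve hx hxb
      exact mem_of_superset ((hδ.isOpen_collar i).mem_nhds (hδ.curve_mem_collar i t)) hcollar
  have huniv : closure (S.object i).body = univ :=
    IsClopen.eq_univ ⟨isClosed_closure, hopen⟩ ⟨_, subset_closure hbody⟩
  exact NormedSpace.unbounded_univ ℝ Plane (huniv ▸ (S.object i).isBounded_body.closure)

lemma collarMap_mem_fluid (hδ : S.IsCollarWidth δ) (i : Fin N) {y : Plane}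
    (hy : y 1 ∈ Ioo 0 δ) : (S.object i).collarMap y ∈ S.fluid := by
  rw [mem_fluid]
  intro j ℓ hclosure
  have hbody : (S.object i).collarMap y + ℓ ∈ (S.object j).body := by
    by_contra hb
    obtain ⟨t, ht⟩ := (S.object j).exists_eq_curve hclosure hb
    rw [← SmoothObject.collarMap_point_zero] at ht
    obtain ⟨-, -, k, hk⟩ := hδ.injective (abs_lt.2 ⟨by linarith [hy.1, hy.2], hy.2⟩)
      (by simpa using hδ.pos) ht.symm
    exact hy.1.ne (by simpa using congrArg (· 1) hk)
  by_cases hij : (i, ℓ) = (j, 0)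
  · obtain ⟨rfl, rfl⟩ := Prod.mk.injEq _ _ _ _ ▸ hij
    exact hδ.collarMap_notMem_body i hy (by simpa using hbody)
  · have hcurve := (hδ.collarMap_mem_body_iff (convex_Ico 0 δ)
      (Ico_subset_Ioo_left (neg_lt_zero.2 hδ.pos)) (fun _ => hij) (Ioo_subset_Ico_self hy)
      (z := point 0 0) (by simp [hδ.pos])).1 hbody
    rw [SmoothObject.collarMap_point_zero] at hcurve
    exact curve_mem_closedFluid i 0 (mem_solid.2 ⟨j, ℓ, hcurve⟩)

lemma collarMap_mem_closedFluid (hδ : S.IsCollarWidth δ) (i : Fin N) {y : Plane}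
    (hy : y 1 ∈ Ico 0 δ) : (S.object i).collarMap y ∈ S.closedFluid := by
  rcases hy.1.eq_or_lt with h | h
  · rw [← point_coords y, ← h, SmoothObject.collarMap_point_zero]
    exact curve_mem_closedFluid i _
  · exact fluid_subset_closedFluid (hδ.collarMap_mem_fluid i ⟨h, hy.2⟩)

end Suspension.IsCollarWidth

lemma subset_or_subset_of_isOpen_cover {X : Type*} [TopologicalSpace X] [PreconnectedSpace X]
    {F U V U' V' : Set X} (hdisj : F ∩ (U ∩ V) = ∅) (hU' : IsOpen U') (hV' : IsOpen V')
    (hcover : ∀ x, x ∈ U' ∪ V') (hinter : U' ∩ V' ⊆ F) (hU : F ∩ U' ⊆ U) (hV : F ∩ V' ⊆ V) :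
    F ⊆ U ∨ F ⊆ V := by
  have hempty : univ ∩ (U' ∩ V') = ∅ := eq_empty_of_forall_notMem fun x ⟨_, hx⟩ =>
    notMem_empty x (hdisj ▸ ⟨hinter hx, hU ⟨hinter hx, hx.1⟩, hV ⟨hinter hx, hx.2⟩⟩)
  exact (isPreconnected_iff_subset_of_disjoint.1 isPreconnected_univ U' V' hU' hV'
    (fun x _ => hcover x) hempty).imp (fun h x hx => hU ⟨hx, h (mem_univ x)⟩)
    fun h x hx => hV ⟨hx, h (mem_univ x)⟩

lemma isPreconnected_of_forall_inter_isPreconnected {X ι : Type*} [TopologicalSpace X]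
    [PreconnectedSpace X] {F : Set X} {T : ι → Set X} (hF : IsOpen F) (hT : ∀ q, IsOpen (T q))
    (hconn : ∀ q, IsPreconnected (T q ∩ F)) (hinter : ∀ q r, q ≠ r → T q ∩ T r ⊆ F)
    (hcover : ∀ x ∉ F, ∃ q, x ∈ T q) : IsPreconnected F := by
  rw [isPreconnected_iff_subset_of_disjoint]
  intro U V hU hV hUV hdisj
  have hside (q : ι) : T q ∩ F ⊆ U ∨ T q ∩ F ⊆ V :=
    isPreconnected_iff_subset_of_disjoint.1 (hconn q) U V hU hV (inter_subset_right.trans hUV)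
      (subset_eq_empty (inter_subset_inter_left _ inter_subset_right) hdisj)
  refine subset_or_subset_of_isOpen_cover hdisj
    (U' := F ∩ U ∪ ⋃ q ∈ {q | T q ∩ F ⊆ U}, T q) (V' := F ∩ V ∪ ⋃ q ∈ {q | ¬ T q ∩ F ⊆ U}, T q)
    ((hF.inter hU).union (isOpen_biUnion fun q _ => hT q))
    ((hF.inter hV).union (isOpen_biUnion fun q _ => hT q)) (fun x => ?_) ?_ ?_ ?_
  · by_cases hx : x ∈ F
    · exact (hUV hx).imp (fun h => Or.inl ⟨hx, h⟩) fun h => Or.inl ⟨hx, h⟩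
    · obtain ⟨q, hq⟩ := hcover x hx
      by_cases h : T q ∩ F ⊆ U
      · exact Or.inl (Or.inr (mem_biUnion h hq))
      · exact Or.inr (Or.inr (mem_biUnion h hq))
  · rintro x ⟨hx | hxU, hx' | hxV⟩
    · exact hx.1
    · exact hx.1
    · exact hx'.1
    · obtain ⟨q, hq, hxq⟩ := mem_iUnion₂.1 hxU
      obtain ⟨r, hr, hxr⟩ := mem_iUnion₂.1 hxV
      exact hinter q r (fun h => hr (h ▸ hq)) ⟨hxq, hxr⟩
  · rintro x ⟨hxF, hx | hx⟩
    · exact hx.2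
    · obtain ⟨q, hq, hxq⟩ := mem_iUnion₂.1 hx
      exact hq ⟨hxq, hxF⟩
  · rintro x ⟨hxF, hx | hx⟩
    · exact hx.2
    · obtain ⟨q, hq, hxq⟩ := mem_iUnion₂.1 hx
      exact (hside q).resolve_left hq ⟨hxq, hxF⟩

namespace Suspension

variable {N : ℕ} {S : Suspension N} {δ : ℝ}

/-- The union of an object and its collar. -/
def objectCollar (S : Suspension N) (δ : ℝ) (i : Fin N) : Set Plane :=
  (S.object i).body ∪ (S.object i).collarMap '' strip (Ioo (-δ) δ)

lemma IsCollarWidth.isOpen_objectCollar (hδ : S.IsCollarWidth δ) (i : Fin N) :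
    IsOpen (S.objectCollar δ i) :=
  (S.object i).isOpen_body.union (hδ.isOpen_collar i)

lemma IsCollarWidth.objectCollar_inter_fluid (hδ : S.IsCollarWidth δ) (i : Fin N) :
    S.objectCollar δ i ∩ S.fluid = (S.object i).collarMap '' strip (Ioo 0 δ) := by
  refine Subset.antisymm ?_ ?_
  · rintro x ⟨hx, hfluid⟩
    have hclosure : x ∉ closure (S.object i).body := by simpa using mem_fluid.1 hfluid i 0
    rcases hx with hx | ⟨y, hy, rfl⟩
    · exact absurd (subset_closure hx) hclosure
    · exact ⟨y, ⟨lt_of_not_ge fun h => hclosure (hδ.collarMap_mem_closure i ⟨hy.1, h⟩), hy.2⟩, rfl⟩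
  · rintro _ ⟨y, hy, rfl⟩
    exact ⟨Or.inr ⟨y, ⟨(neg_neg_of_pos hδ.pos).trans hy.1, hy.2⟩, rfl⟩,
      hδ.collarMap_mem_fluid i hy⟩

lemma IsCollarWidth.mem_closure_of_mem_objectCollar (hδ : S.IsCollarWidth δ) {i : Fin N}
    {x : Plane} (hx : x ∈ S.objectCollar δ i) (hfluid : x ∉ S.fluid) :
    x ∈ closure (S.object i).body := by
  rcases hx with hx | ⟨y, hy, rfl⟩
  · exact subset_closure hx
  · refine hδ.collarMap_mem_closure i ⟨hy.1, ?_⟩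
    by_contra! h
    exact hfluid (hδ.collarMap_mem_fluid i ⟨h, hy.2⟩)

lemma IsCollarWidth.closure_subset_objectCollar (hδ : S.IsCollarWidth δ) (i : Fin N) :
    closure (S.object i).body ⊆ S.objectCollar δ i := fun x hx => by
  by_cases hb : x ∈ (S.object i).body
  · exact Or.inl hb
  · obtain ⟨t, rfl⟩ := (S.object i).exists_eq_curve hx hb
    exact Or.inr (hδ.curve_mem_collar i t)

theorem isPreconnected_fluid : IsPreconnected S.fluid := by
  obtain ⟨δ, hδ⟩ := S.exists_isCollarWidth
  refine isPreconnected_of_forall_inter_isPreconnected (ι := Fin N × S.lattice)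
    (T := fun q => {x | x + (q.2 : Plane) ∈ S.objectCollar δ q.1}) isOpen_fluid
    (fun q => (hδ.isOpen_objectCollar q.1).preimage (continuous_add_const _))
    (fun ⟨i, ℓ⟩ => ?_) (fun ⟨i, ℓ⟩ ⟨j, ℓ'⟩ hne x hx => ?_) fun x hx => ?_
  · have himage : {x | x + (ℓ : Plane) ∈ S.objectCollar δ i} ∩ S.fluid =
        (fun y => (S.object i).collarMap y - ℓ) '' strip (Ioo 0 δ) := by
      ext x
      have h := Set.ext_iff.1 (hδ.objectCollar_inter_fluid i) (x + ℓ)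
      simp only [mem_inter_iff, add_mem_fluid, mem_image] at h
      simpa only [mem_inter_iff, mem_ofPred_eq, mem_image, sub_eq_iff_eq_add] using h
    rw [himage]
    exact (convex_strip (convex_Ioo _ _)).isPreconnected.image _ (by fun_prop)
  · by_contra hfluid
    have hi := hδ.mem_closure_of_mem_objectCollar hx.1 (mt (add_mem_fluid ℓ).1 hfluid)
    have hj := hδ.mem_closure_of_mem_objectCollar hx.2 (mt (add_mem_fluid ℓ').1 hfluid)
    exact hne (Prod.ext_iff.2 (eq_of_mem_closure hi hj))
  · obtain ⟨i, ℓ, h⟩ := mem_closure_solid.1 (not_not.1 hx)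
    exact ⟨(i, ℓ), hδ.closure_subset_objectCollar i h⟩

theorem closedFluid_subset_closure_fluid : S.closedFluid ⊆ closure S.fluid := fun x hx => by
  obtain ⟨δ, hδ⟩ := S.exists_isCollarWidth
  by_cases hfluid : x ∈ S.fluid
  · exact subset_closure hfluid
  obtain ⟨i, ℓ, t, ht⟩ := exists_curve_eq_add hx hfluid
  have hcont : Continuous fun s => (S.object i).collarMap (point t s) - (ℓ : Plane) := by fun_prop
  have hlim := hcont.continuousWithinAt (s := Ioi 0) (x := 0)
  rw [ContinuousWithinAt, SmoothObject.collarMap_point_zero, ht, add_sub_cancel_right] at hlim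
  refine mem_closure_of_tendsto hlim ?_
  filter_upwards [Ioo_mem_nhdsGT hδ.pos] with s hs
  rw [← add_mem_fluid ℓ, sub_add_cancel]
  exact hδ.collarMap_mem_fluid i (by simpa using hs)

theorem uniqueDiffOn_closedFluid : UniqueDiffOn ℝ S.closedFluid := fun x hx => by
  obtain ⟨δ, hδ⟩ := S.exists_isCollarWidth
  by_cases hfluid : x ∈ S.fluid
  · exact (isOpen_fluid.uniqueDiffOn x hfluid).mono fluid_subset_closedFluid
  obtain ⟨i, ℓ, t, ht⟩ := exists_curve_eq_add hx hfluid
  have hstrip : UniqueDiffWithinAt ℝ (strip (Ico 0 δ)) (point t 0) := by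
    refine uniqueDiffOn_convex (convex_strip (convex_Ico _ _)) ?_ _ (by simp [hδ.pos])
    exact ⟨point 0 (δ / 2), interior_maximal (preimage_mono Ioo_subset_Ico_self)
      (isOpen_strip isOpen_Ioo) (by simp [hδ.pos])⟩
  have hderiv : HasFDerivWithinAt (fun y => (S.object i).collarMap y - ℓ)
      (fderiv ℝ (S.object i).collarMap (point t 0)) (strip (Ico 0 δ)) (point t 0) :=
    (((S.object i).differentiable_collarMap _).hasFDerivAt.sub_const _).hasFDerivWithinAt
  have hdet : (fderiv ℝ (S.object i).collarMap (point t 0)).det ≠ 0 :=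
    (hδ.jacobian_neg i (point t 0) (by simpa using hδ.pos)).ne
  have hrange : DenseRange (fderiv ℝ (S.object i).collarMap (point t 0)) := by
    rw [← ContinuousLinearMap.coe_toContinuousLinearEquivOfDetNeZero _ hdet]
    exact (ContinuousLinearEquiv.surjective _).denseRange
  have hx := hderiv.uniqueDiffWithinAt hstrip hrange
  rw [SmoothObject.collarMap_point_zero, ht, add_sub_cancel_right] at hx
  refine hx.mono ?_
  rintro _ ⟨z, hz, rfl⟩
  rw [← add_mem_closedFluid ℓ, sub_add_cancel]
  exact hδ.collarMap_mem_closedFluid i hz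

end Suspension

/-- A smooth monotone step, which is zero up to `1 / 2` and one from `1` on. It is the profile of
the cutoff functions. -/
def smoothStep (r : ℝ) : ℝ := Real.smoothTransition (2 * r - 1)

lemma contDiff_smoothStep {n : ℕ∞} : ContDiff ℝ n smoothStep :=
  Real.smoothTransition.contDiff.comp (by fun_prop)

lemma smoothStep_eq_zero {r : ℝ} (h : r ≤ 1 / 2) : smoothStep r = 0 :=
  Real.smoothTransition.zero_of_nonpos (by linarith)

lemma smoothStep_eq_one {r : ℝ} (h : 1 ≤ r) : smoothStep r = 1 :=
  Real.smoothTransition.one_of_one_le (by linarith)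

lemma smoothStep_nonneg (r : ℝ) : 0 ≤ smoothStep r := Real.smoothTransition.nonneg _

lemma monotone_smoothStep : Monotone smoothStep := fun r s h =>
  Real.smoothTransition.monotone (by linarith)

namespace Suspension

variable {N : ℕ} (S : Suspension N)

/-- `y` are coordinates of `x` in the collar of some translate of one of the objects. -/
def IsCollarCoord (x y : Plane) : Prop :=
  ∃ (i : Fin N) (ℓ : S.lattice), x + ℓ = (S.object i).collarMap y

open Classical in
/-- The signed depth of a point within the collars of width `δ`: the second collar coordinate, which
is positive in the fluid and negative in the objects. Outside of the collars its value is `δ` in the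
fluid and `-δ` in the objects. -/
def depth (δ : ℝ) (x : Plane) : ℝ :=
  if h : ∃ y, |y 1| < δ ∧ S.IsCollarCoord x y then h.choose 1
  else if x ∈ S.solid then -δ else δ

/-- The cutoff function that vanishes in the objects and near their boundaries, and is one in the
fluid at depth at least `b`. -/
def cutoff (δ b : ℝ) (x : Plane) : ℝ := smoothStep (S.depth δ x / b)

variable {S} {δ b : ℝ} {x y : Plane}

lemma isCollarCoord_collarMap (i : Fin N) (y : Plane) :
    S.IsCollarCoord ((S.object i).collarMap y) y := ⟨i, 0, by simp⟩

lemma isCollarCoord_add (ℓ : S.lattice) : S.IsCollarCoord (x + ℓ) y ↔ S.IsCollarCoord x y := by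
  refine exists_congr fun i => ⟨fun ⟨m, h⟩ => ⟨ℓ + m, ?_⟩, fun ⟨m, h⟩ => ⟨m - ℓ, ?_⟩⟩
  · simpa [add_assoc] using h
  · simpa [add_assoc] using h

lemma isClosed_exists_isCollarCoord (c : ℝ) :
    IsClosed {x | ∃ y : Plane, |y 1| ≤ c ∧ S.IsCollarCoord x y} := by
  let K (i : Fin N) : Set Plane := (fun q : ℝ × ℝ => (S.object i).collarMap (point q.1 q.2)) ''
    (Icc 0 (2 * π) ×ˢ Icc (-c) c)
  have hK (i : Fin N) : IsCompact (K i) :=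
    (isCompact_Icc.prod isCompact_Icc).image (by fun_prop)
  have heq : {x | ∃ y : Plane, |y 1| ≤ c ∧ S.IsCollarCoord x y} =
      ⋃ q : Fin N × S.lattice, {x | x + (q.2 : Plane) ∈ K q.1} := by
    refine Subset.antisymm ?_ (iUnion_subset ?_)
    · rintro x ⟨y, hy, i, ℓ, hx⟩
      obtain ⟨t, ht, k, hk⟩ := exists_eq_point_add_period y
      refine mem_iUnion.2 ⟨(i, ℓ), (t, y 1), ⟨Ico_subset_Icc_self ht, abs_le.1 hy⟩, ?_⟩
      rw [hk, (S.object i).periodic_collarMap.zsmul] at hx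
      exact hx.symm
    · rintro ⟨i, ℓ⟩ x ⟨⟨t, s⟩, ⟨-, hs⟩, hx⟩
      exact ⟨point t s, by simpa using abs_le.2 hs, i, ℓ, hx.symm⟩
  rw [heq]
  exact (locallyFinite_translates fun i => (hK i).isBounded).isClosed_iUnion fun q =>
    (hK q.1).isClosed.preimage (continuous_add_const _)

lemma cutoff_nonneg (x : Plane) : 0 ≤ S.cutoff δ b x := smoothStep_nonneg _

lemma cutoff_eq_zero (hb : 0 < b) (h : S.depth δ x ≤ b / 2) : S.cutoff δ b x = 0 :=
  smoothStep_eq_zero (by rw [div_le_iff₀ hb]; linarith)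

lemma cutoff_eq_one (hb : 0 < b) (h : b ≤ S.depth δ x) : S.cutoff δ b x = 1 :=
  smoothStep_eq_one ((one_le_div₀ hb).2 h)

lemma cutoff_anti {c : ℝ} (hb : 0 < b) (hbc : b ≤ c) (x : Plane) :
    S.cutoff δ c x ≤ S.cutoff δ b x := by
  rcases le_total (S.depth δ x) 0 with h | h
  · rw [cutoff_eq_zero (hb.trans_le hbc) (h.trans (half_pos (hb.trans_le hbc)).le)]
    exact cutoff_nonneg x
  · exact monotone_smoothStep (div_le_div_of_nonneg_left h hb hbc)

namespace IsCollarWidth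

lemma eq_of_isCollarCoord (hδ : S.IsCollarWidth δ) {z : Plane} (hy : |y 1| < δ) (hz : |z 1| < δ)
    (hxy : S.IsCollarCoord x y) (hxz : S.IsCollarCoord x z) : z 1 = y 1 := by
  obtain ⟨i, ℓ, hxy⟩ := hxy
  obtain ⟨j, m, hxz⟩ := hxz
  obtain ⟨-, -, k, rfl⟩ := hδ.injective (i := i) (j := j) (ℓ := m - ℓ) hy hz (by
    rw [← hxy, ← hxz, AddSubgroupClass.coe_sub]; abel)
  simp

lemma depth_eq (hδ : S.IsCollarWidth δ) (hy : |y 1| < δ) (hxy : S.IsCollarCoord x y) :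
    S.depth δ x = y 1 := by
  have h : ∃ y, |y 1| < δ ∧ S.IsCollarCoord x y := ⟨y, hy, hxy⟩
  rw [depth, dif_pos h]
  exact hδ.eq_of_isCollarCoord hy h.choose_spec.1 hxy h.choose_spec.2

lemma depth_collarMap (hδ : S.IsCollarWidth δ) (i : Fin N) (hy : |y 1| < δ) :
    S.depth δ ((S.object i).collarMap y) = y 1 :=
  hδ.depth_eq hy (isCollarCoord_collarMap i y)

lemma depth_mem_Icc (hδ : S.IsCollarWidth δ) (x : Plane) : S.depth δ x ∈ Icc (-δ) δ := by
  have hpos := hδ.pos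
  unfold depth
  split_ifs with h
  · exact abs_le.1 h.choose_spec.1.le
  · exact ⟨le_rfl, by linarith⟩
  · exact ⟨by linarith, le_rfl⟩

lemma exists_isCollarCoord (hδ : S.IsCollarWidth δ) (h : |S.depth δ x| < δ) :
    ∃ y, |y 1| < δ ∧ S.IsCollarCoord x y := by
  by_contra hx
  rw [depth, dif_neg hx] at h
  split_ifs at h
  · rw [abs_neg, abs_of_pos hδ.pos] at h; exact h.false
  · rw [abs_of_pos hδ.pos] at h; exact h.false

lemma depth_pos_iff (hδ : S.IsCollarWidth δ) : 0 < S.depth δ x ↔ x ∈ S.fluid := by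
  by_cases h : ∃ y, |y 1| < δ ∧ S.IsCollarCoord x y
  · obtain ⟨y, hy, i, ℓ, hx⟩ := h
    rw [hδ.depth_eq hy ⟨i, ℓ, hx⟩, ← add_mem_fluid ℓ, hx]
    refine ⟨fun h => hδ.collarMap_mem_fluid i ⟨h, (abs_lt.1 hy).2⟩, fun h => ?_⟩
    by_contra! hneg
    have hclosure := hδ.collarMap_mem_closure i ⟨(abs_lt.1 hy).1, hneg⟩
    exact mem_fluid.1 h i 0 (by simpa using hclosure)
  · have hfluid : x ∈ S.fluid ↔ x ∉ S.solid := by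
      refine ⟨fun hx => fluid_subset_closedFluid hx, fun hx => ?_⟩
      by_contra hx'
      obtain ⟨i, ℓ, t, ht⟩ := exists_curve_eq_add hx hx'
      rw [← SmoothObject.collarMap_point_zero] at ht
      exact h ⟨point t 0, by simpa using hδ.pos, i, ℓ, ht.symm⟩
    rw [depth, dif_neg h, hfluid]
    split_ifs with hs <;> simp [hs, hδ.pos, hδ.pos.le]

lemma depth_neg_of_mem_solid (hδ : S.IsCollarWidth δ) (hx : x ∈ S.solid) : S.depth δ x < 0 := by
  by_cases h : ∃ y, |y 1| < δ ∧ S.IsCollarCoord x y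
  · obtain ⟨y, hy, i, ℓ, hxy⟩ := h
    rw [hδ.depth_eq hy ⟨i, ℓ, hxy⟩]
    by_contra! hpos
    have hclosed := hδ.collarMap_mem_closedFluid i ⟨hpos, (abs_lt.1 hy).2⟩
    rw [← hxy, add_mem_closedFluid] at hclosed
    exact hclosed hx
  · rw [depth, dif_neg h, if_pos hx]
    exact neg_neg_of_pos hδ.pos

lemma depth_add (hδ : S.IsCollarWidth δ) (ℓ : S.lattice) (x : Plane) :
    S.depth δ (x + ℓ) = S.depth δ x := by
  by_cases h : ∃ y, |y 1| < δ ∧ S.IsCollarCoord x y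
  · obtain ⟨y, hy, hxy⟩ := h
    rw [hδ.depth_eq hy hxy, hδ.depth_eq hy ((isCollarCoord_add ℓ).2 hxy)]
  · have h' : ¬∃ y, |y 1| < δ ∧ S.IsCollarCoord (x + ℓ) y := by
      simpa only [isCollarCoord_add] using h
    rw [depth, depth, dif_neg h, dif_neg h', add_mem_solid]

lemma contDiffAt_depth (hδ : S.IsCollarWidth δ) (h : |S.depth δ x| < δ) :
    ContDiffAt ℝ (⊤ : ℕ∞) (S.depth δ) x := by
  obtain ⟨y, hy, i, ℓ, hxy⟩ := hδ.exists_isCollarCoord h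
  obtain ⟨e, he, hcoe, hsymm⟩ :=
    (S.object i).exists_localInverse_collarMap (hδ.jacobian_neg i y hy).ne
  rw [← hxy] at hsymm
  have htarget : x + ℓ ∈ e.target := by rw [hxy, ← hcoe]; exact e.map_source he
  have hinv : e.symm (x + ℓ) = y := by rw [hxy, ← hcoe, e.left_inv he]
  have hlocal : ContDiffAt ℝ (⊤ : ℕ∞) (fun z => e.symm (z + ℓ)) x :=
    ContDiffAt.comp x (g := e.symm) (f := fun z => z + (ℓ : Plane)) hsymm (by fun_prop)
  refine ((contDiff_apply 1).contDiffAt.comp x hlocal).congr_of_eventuallyEq ?_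
  have hstrip : ∀ᶠ z in 𝓝 x, e.symm (z + ℓ) ∈ strip (Ioo (-δ) δ) :=
    hlocal.continuousAt.eventually_mem ((isOpen_strip isOpen_Ioo).mem_nhds (by
      rw [hinv]; exact abs_lt.1 hy))
  have hmem : ∀ᶠ z in 𝓝 x, z + (ℓ : Plane) ∈ e.target :=
    (continuous_add_const (ℓ : Plane)).continuousAt.eventually_mem
      (e.open_target.mem_nhds htarget)
  filter_upwards [hstrip, hmem] with z hz hzt
  exact hδ.depth_eq (abs_lt.2 hz) ⟨i, ℓ, by rw [← hcoe, e.right_inv hzt]⟩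

lemma eventually_lt_abs_depth (hδ : S.IsCollarWidth δ) (h : δ ≤ |S.depth δ x|) {c : ℝ}
    (hc : c < δ) : ∀ᶠ z in 𝓝 x, c < |S.depth δ z| := by
  have hx : x ∉ {x | ∃ y : Plane, |y 1| ≤ c ∧ S.IsCollarCoord x y} := by
    rintro ⟨y, hy, hxy⟩
    rw [hδ.depth_eq (hy.trans_lt hc) hxy] at h
    exact (h.trans hy).not_gt hc
  filter_upwards [(isClosed_exists_isCollarCoord c).isOpen_compl.mem_nhds hx] with z hz
  by_contra! hzc
  obtain ⟨y, hy, hzy⟩ := hδ.exists_isCollarCoord (hzc.trans_lt hc)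
  exact hz ⟨y, by rwa [← hδ.depth_eq hy hzy], hzy⟩

lemma continuous_depth (hδ : S.IsCollarWidth δ) : Continuous (S.depth δ) :=
  continuous_iff_continuousAt.2 fun x => by
    have hbound := hδ.depth_mem_Icc
    rcases lt_or_ge |S.depth δ x| δ with h | h
    · exact (hδ.contDiffAt_depth h).continuousAt
    have hx₀ : S.depth δ x ≠ 0 := by
      rintro h₀
      rw [h₀, abs_zero] at h
      exact h.not_gt hδ.pos
    by_cases hx : x ∈ S.fluid
    · have hpos := hδ.depth_pos_iff.2 hx
      rw [abs_of_pos hpos] at h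
      rw [ContinuousAt, (hbound x).2.antisymm h, tendsto_order]
      refine ⟨fun c hc => ?_, fun c hc => .of_forall fun z => (hbound z).2.trans_lt hc⟩
      filter_upwards [hδ.eventually_lt_abs_depth (h.trans (le_abs_self _)) hc,
        isOpen_fluid.mem_nhds hx] with z hz hzf
      rwa [abs_of_pos (hδ.depth_pos_iff.2 hzf)] at hz
    · have hsolid : x ∈ S.solid := by
        by_contra hs
        obtain ⟨i, ℓ, t, ht⟩ := exists_curve_eq_add hs hx
        rw [← SmoothObject.collarMap_point_zero] at ht
        exact hx₀ (by rw [hδ.depth_eq (by simpa using hδ.pos) ⟨i, ℓ, ht.symm⟩, point_one])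
      have hneg := hδ.depth_neg_of_mem_solid hsolid
      have hx' : S.depth δ x = -δ := (hbound x).1.antisymm' (by
        rw [abs_of_neg hneg] at h; linarith)
      rw [ContinuousAt, hx', tendsto_order]
      refine ⟨fun c hc => .of_forall fun z => hc.trans_le (hbound z).1, fun c hc => ?_⟩
      filter_upwards [hδ.eventually_lt_abs_depth h (c := -c) (by linarith),
        isOpen_solid.mem_nhds hsolid] with z hz hzs
      rw [abs_of_neg (hδ.depth_neg_of_mem_solid hzs)] at hz
      linarith

lemma cutoff_eventuallyEq_zero (hδ : S.IsCollarWidth δ) (hb : 0 < b) (hx : S.depth δ x ≤ 0) :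
    S.cutoff δ b =ᶠ[𝓝 x] 0 := by
  filter_upwards [hδ.continuous_depth.continuousAt.eventually_lt continuousAt_const
    (hx.trans_lt (half_pos hb))] with z hz using cutoff_eq_zero hb hz.le

lemma cutoff_eventuallyEq_one (hδ : S.IsCollarWidth δ) (hb : 0 < b) (hx : b < S.depth δ x) :
    S.cutoff δ b =ᶠ[𝓝 x] 1 := by
  filter_upwards [continuousAt_const.eventually_lt hδ.continuous_depth.continuousAt hx] with z hz
  exact cutoff_eq_one hb hz.le

lemma contDiff_cutoff (hδ : S.IsCollarWidth δ) (hb : 0 < b) (hbδ : b < δ) :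
    ContDiff ℝ (⊤ : ℕ∞) (S.cutoff δ b) := contDiff_iff_contDiffAt.2 fun x => by
  rcases le_or_gt (S.depth δ x) 0 with h | hpos
  · exact contDiffAt_const.congr_of_eventuallyEq (hδ.cutoff_eventuallyEq_zero hb h)
  rcases lt_or_ge b (S.depth δ x) with h | h
  · exact contDiffAt_const.congr_of_eventuallyEq (hδ.cutoff_eventuallyEq_one hb h)
  · have hdepth := hδ.contDiffAt_depth (abs_lt.2 ⟨by linarith, h.trans_lt hbδ⟩)
    exact contDiff_smoothStep.contDiffAt.comp x (hdepth.div_const b)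

lemma fderiv_cutoff_eq_zero (hδ : S.IsCollarWidth δ) (hb : 0 < b) (h : S.depth δ x ∉ Ioc 0 b) :
    fderiv ℝ (S.cutoff δ b) x = 0 := by
  rcases le_or_gt (S.depth δ x) 0 with h₀ | h₀
  · rw [(hδ.cutoff_eventuallyEq_zero hb h₀).fderiv_eq]; simp
  · rw [(hδ.cutoff_eventuallyEq_one hb (not_le.1 fun hle => h ⟨h₀, hle⟩)).fderiv_eq]; simp

lemma fderiv_cutoff_collarMap (hδ : S.IsCollarWidth δ) (hb : 0 < b) (hbδ : b < δ) (i : Fin N)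
    (hy : |y 1| < δ) (w : Plane) :
    fderiv ℝ (S.cutoff δ b) ((S.object i).collarMap y) (fderiv ℝ (S.object i).collarMap y w) =
      b⁻¹ * deriv smoothStep (y 1 / b) * w 1 := by
  have hcomp : HasFDerivAt (fun z => S.cutoff δ b ((S.object i).collarMap z)) _ y :=
    ((hδ.contDiff_cutoff hb hbδ).differentiable (by simp) _).hasFDerivAt.comp y
      ((S.object i).differentiable_collarMap y).hasFDerivAt
  have hcoord : HasFDerivAt (fun z : Plane => z 1 / b)
      (b⁻¹ • (EuclideanSpace.proj 1 : Plane →L[ℝ] ℝ)) y := by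
    simp only [div_eq_inv_mul]
    exact (EuclideanSpace.proj 1 : Plane →L[ℝ] ℝ).hasFDerivAt.const_mul b⁻¹
  have hstep : HasFDerivAt (fun z : Plane => smoothStep (z 1 / b)) _ y :=
    ((contDiff_smoothStep (n := 1)).differentiable (by simp) (y 1 / b)).hasDerivAt.comp_hasFDerivAt
      (h₂ := smoothStep) y hcoord
  have heq : (fun z => S.cutoff δ b ((S.object i).collarMap z)) =ᶠ[𝓝 y]
      fun z => smoothStep (z 1 / b) := by
    filter_upwards [(isOpen_strip isOpen_Ioo).mem_nhds
      (show y ∈ strip (Ioo (-δ) δ) from abs_lt.1 hy)] with z hz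
    rw [cutoff, hδ.depth_collarMap i (abs_lt.2 hz)]
  rw [mul_comm b⁻¹, mul_assoc]
  exact congrArg (fun L : Plane →L[ℝ] ℝ => L w)
    (hcomp.unique (hstep.congr_of_eventuallyEq heq))

end IsCollarWidth

end Suspension

lemma integrableOn_of_continuous_of_isBounded {X E : Type*} [MetricSpace X] [ProperSpace X]
    [MeasurableSpace X] [OpensMeasurableSpace X] [NormedAddCommGroup E] {ν : Measure X}
    [IsFiniteMeasureOnCompacts ν] {f : X → E} {A : Set X} (hf : Continuous f)
    (hA : Bornology.IsBounded A) : IntegrableOn f A ν :=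
  (hf.continuousOn.integrableOn_compact hA.isCompact_closure).mono_set subset_closure

lemma setIntegral_fundamentalDomain_eq {G X E : Type*} [AddGroup G] [Countable G] [AddAction G X]
    [MeasurableSpace X] [MeasurableConstVAdd G X] [NormedAddCommGroup E] [NormedSpace ℝ E]
    {ν : Measure X} [VAddInvariantMeasure G X ν] {D A : Set X} {f : X → E}
    (hD : IsAddFundamentalDomain G D ν) (hA : MeasurableSet A) (hfD : IntegrableOn f D ν)
    (hfA : IntegrableOn f A ν) (hinv : ∀ (g : G) x, f (g +ᵥ x) = f x)
    (hdisj : Pairwise (Function.onFun Disjoint fun g : G => g +ᵥ A))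
    (hsupp : Function.support f ⊆ ⋃ g : G, g +ᵥ A) :
    ∫ x in D, f x ∂ν = ∫ x in A, f x ∂ν := by
  have hcell : ∫ x in D, f x ∂ν = ∫ x in ⋃ g : G, (g +ᵥ A) ∩ D, f x ∂ν := by
    refine setIntegral_eq_of_subset_of_ae_sdiff_eq_zero hD.nullMeasurableSet
      (iUnion_subset fun g => inter_subset_right) (.of_forall fun x hx => ?_)
    rw [← iUnion_inter] at hx
    exact Function.notMem_support.1 fun h => hx.2 ⟨hsupp h, hx.1⟩
  rw [hcell, hD.setIntegral_eq_tsum' hfA, integral_iUnion_ae]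
  · simp only [hinv]
  · exact fun g => (hA.const_vadd g).nullMeasurableSet.inter hD.nullMeasurableSet
  · exact fun g g' h => ((hdisj h).mono inter_subset_left inter_subset_left).aedisjoint
  · exact hfD.mono_set (iUnion_subset fun g => inter_subset_right)

namespace Suspension

variable {N : ℕ} (S : Suspension N)

/-- A unit cell of the suspension: the half-open parallelogram spanned by the lattice vectors. -/
def cell : Set Plane := ZSpan.fundamentalDomain S.basis

/-- Double periodicity, with respect to the lattice of the suspension. -/
def IsPeriodic {E : Type*} (f : Plane → E) : Prop := ∀ x, ∀ ℓ : S.lattice, f (x + ℓ) = f x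

variable {S}

instance : VAddInvariantMeasure S.lattice Plane volume :=
  inferInstanceAs (VAddInvariantMeasure S.lattice.toAddSubgroup Plane volume)

lemma isAddFundamentalDomain_cell : IsAddFundamentalDomain S.lattice S.cell volume :=
  ZSpan.isAddFundamentalDomain S.basis volume

lemma isBounded_cell : Bornology.IsBounded S.cell := ZSpan.fundamentalDomain_isBounded S.basis

lemma measurableSet_cell : MeasurableSet S.cell := ZSpan.fundamentalDomain_measurableSet S.basis

lemma IsPeriodic.vadd {E : Type*} {f : Plane → E} (hf : S.IsPeriodic f) (ℓ : S.lattice)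
    (x : Plane) : f (ℓ +ᵥ x) = f x := by
  rw [Submodule.vadd_def, vadd_eq_add, add_comm, hf]

lemma IsPeriodic.fderiv {E : Type*} [NormedAddCommGroup E] [NormedSpace ℝ E] {f : Plane → E}
    (hf : S.IsPeriodic f) : S.IsPeriodic (fderiv ℝ f) := fun x ℓ => by
  rw [← fderiv_comp_add_right]
  simp only [hf _ ℓ]

lemma integral_cell_add {E : Type*} [NormedAddCommGroup E] [NormedSpace ℝ E] {f : Plane → E}
    (hf : S.IsPeriodic f) (w : Plane) : ∫ x in S.cell, f (x + w) = ∫ x in S.cell, f x := by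
  rw [isAddFundamentalDomain_cell.setIntegral_eq (isAddFundamentalDomain_cell.vadd_of_comm w)
    hf.vadd, ← image_vadd, (measurePreserving_vadd w volume).setIntegral_image_emb
    (measurableEmbedding_const_vadd w)]
  simp only [vadd_eq_add, add_comm]

/-- By translation invariance, `∫ f (x + s • w)` over a cell does not depend on `s`. -/
lemma integral_cell_fderiv {f : Plane → ℝ} (hf : ContDiff ℝ 1 f) (hper : S.IsPeriodic f)
    (w : Plane) : ∫ x in S.cell, fderiv ℝ f x w = 0 := by
  have hcont : Continuous fun q : Plane × ℝ => fderiv ℝ f (q.1 + q.2 • w) w :=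
    ((hf.continuous_fderiv one_ne_zero).comp (by fun_prop)).clm_apply continuous_const
  obtain ⟨C, hC⟩ := ((isBounded_cell (S := S)).isCompact_closure.prod
    (isCompact_closedBall (0 : ℝ) 1)).exists_bound_of_continuousOn hcont.continuousOn
  have : IsFiniteMeasure (volume.restrict S.cell) :=
    isFiniteMeasure_restrict.2 isBounded_cell.measure_lt_top.ne
  have hderiv : HasDerivAt (fun s : ℝ => ∫ x in S.cell, f (x + s • w))
      (∫ x in S.cell, fderiv ℝ f (x + (0 : ℝ) • w) w) 0 := by
    refine (hasDerivAt_integral_of_dominated_loc_of_deriv_le (bound := fun _ => C)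
      (F' := fun s x => fderiv ℝ f (x + s • w) w) (Metric.ball_mem_nhds 0 one_pos)
      (.of_forall fun s => (hf.continuous.comp (by fun_prop)).aestronglyMeasurable)
      (integrableOn_of_continuous_of_isBounded (hf.continuous.comp (by fun_prop)) isBounded_cell)
      (hcont.comp (by fun_prop : Continuous fun x : Plane => (x, (0 : ℝ)))).aestronglyMeasurable
      ?_ (integrable_const C) (.of_forall fun x s _ => ?_)).2
    · filter_upwards [ae_restrict_mem measurableSet_cell] with x hx s hs
      exact hC (x, s) ⟨subset_closure hx, Metric.ball_subset_closedBall hs⟩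
    · have hline : HasDerivAt (fun s : ℝ => x + s • w) w s := by
        simpa using ((hasDerivAt_id s).smul_const w).const_add x
      exact (hf.differentiable one_ne_zero _).hasFDerivAt.comp_hasDerivAt s hline
  simp only [integral_cell_add hper, zero_smul, add_zero] at hderiv
  exact hderiv.unique (hasDerivAt_const _ _)

lemma eq_zero_of_integral_cell_nonpos {f : Plane → ℝ} (hf : Continuous f) (hper : S.IsPeriodic f)
    (hnonneg : ∀ x, 0 ≤ f x) (hint : ∫ x in S.cell, f x ≤ 0) : f = 0 := by
  have hzero : f =ᵐ[volume.restrict S.cell] 0 := (integral_eq_zero_iff_of_nonneg hnonneg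
    (integrableOn_of_continuous_of_isBounded hf isBounded_cell)).1
      (hint.antisymm (integral_nonneg hnonneg))
  refine (hf.ae_eq_iff_eq volume continuous_const).1 (ae_iff.2 ?_)
  refine isAddFundamentalDomain_cell.measure_zero_of_invariant (G := S.lattice) _ (fun ℓ => ?_) ?_
  · ext x
    rw [mem_vadd_set_iff_neg_vadd_mem]
    simp only [mem_ofPred_eq, hper.vadd]
  · rw [← Measure.restrict_apply' measurableSet_cell]
    exact ae_iff.1 hzero

end Suspension

lemma measurePreserving_point : MeasurePreserving fun q : ℝ × ℝ => point q.2 q.1 :=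
  (PiLp.volume_preserving_toLp (Fin 2)).comp
    ((volume_preserving_finTwoArrow ℝ).symm.comp Measure.measurePreserving_swap)

lemma measurableEmbedding_point : MeasurableEmbedding fun q : ℝ × ℝ => point q.2 q.1 :=
  Continuous.measurableEmbedding (by fun_prop) fun p q h =>
    Prod.ext (by simpa using congrArg (· 1) h) (by simpa using congrArg (· 0) h)

/-- The part of the strip `0 < y₁ ≤ b` that the collar maps take to one full turn around the
object. -/
def collarBox (b : ℝ) : Set Plane := {y | y 0 ∈ Ico 0 (2 * π) ∧ y 1 ∈ Ioc 0 b}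

lemma measurableSet_collarBox (b : ℝ) : MeasurableSet (collarBox b) :=
  (measurableSet_Ico.preimage (by fun_prop)).inter (measurableSet_Ioc.preimage (by fun_prop))

lemma isBounded_collarBox (b : ℝ) : Bornology.IsBounded (collarBox b) :=
  ((isCompact_Icc (a := (0 : ℝ)) (b := 2 * π)).prod (isCompact_Icc (a := (0 : ℝ)) (b := b))).image
    (f := fun q : ℝ × ℝ => point q.1 q.2) (by fun_prop) |>.isBounded.subset fun y hy =>
      ⟨(y 0, y 1), ⟨Ico_subset_Icc_self hy.1, Ioc_subset_Icc_self hy.2⟩, point_coords y⟩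

lemma setIntegral_collarBox {b : ℝ} (hb : 0 ≤ b) {g : Plane → ℝ}
    (hg : ContinuousOn (fun q : ℝ × ℝ => g (point q.2 q.1)) (Icc 0 b ×ˢ Icc 0 (2 * π))) :
    ∫ y in collarBox b, g y = ∫ s in 0..b, ∫ t in 0..2 * π, g (point t s) := by
  have hpre : (fun q : ℝ × ℝ => point q.2 q.1) ⁻¹' collarBox b = Ioc 0 b ×ˢ Ico 0 (2 * π) := by
    ext q; simp [collarBox, and_comm]
  have hint : IntegrableOn (fun q : ℝ × ℝ => g (point q.2 q.1)) (Ioc 0 b ×ˢ Ico 0 (2 * π)) :=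
    (hg.integrableOn_compact (isCompact_Icc.prod isCompact_Icc)).mono_set
      (prod_mono Ioc_subset_Icc_self Ico_subset_Icc_self)
  rw [← measurePreserving_point.setIntegral_preimage_emb measurableEmbedding_point, hpre,
    Measure.volume_eq_prod, setIntegral_prod _ hint, intervalIntegral.integral_of_le hb]
  simp only [integral_Ico_eq_integral_Ioc, intervalIntegral.integral_of_le Real.two_pi_pos.le]

lemma integral_deriv_smoothStep : ∫ r in (0 : ℝ)..1, deriv smoothStep r = 1 := by
  rw [intervalIntegral.integral_deriv_eq_sub
    (fun r _ => (contDiff_smoothStep (n := 1)).differentiable (by simp) r)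
    (((contDiff_smoothStep (n := 1)).continuous_deriv (by simp)).intervalIntegrable _ _),
    smoothStep_eq_one le_rfl, smoothStep_eq_zero (by norm_num), sub_zero]

/-- The substitution `s = b * r` turns the integral into one that is continuous in `b` up to
`b = 0`. -/
lemma tendsto_integral_deriv_smoothStep {Φ : ℝ → ℝ} {c : ℝ} (hc : 0 < c)
    (hΦ : ContinuousOn Φ (Icc 0 c)) :
    Tendsto (fun b => ∫ s in 0..b, b⁻¹ * deriv smoothStep (s / b) * Φ s) (𝓝[>] 0) (𝓝 (Φ 0)) := by
  let Ψ : ℝ → ℝ := IccExtend hc.le ((Icc 0 c).domRestrict Φ)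
  have hΨ : Continuous Ψ := (continuousOn_iff_continuous_domRestrict.1 hΦ).Icc_extend'
  have hΨΦ {s : ℝ} (hs : s ∈ Icc 0 c) : Ψ s = Φ s := IccExtend_of_mem hc.le _ hs
  have hstep : Continuous (deriv smoothStep) :=
    (contDiff_smoothStep (n := 1)).continuous_deriv (by simp)
  have hcont : Continuous fun b => ∫ r in (0 : ℝ)..1, deriv smoothStep r * Ψ (b * r) :=
    intervalIntegral.continuous_parametric_intervalIntegral_of_continuous' (by fun_prop) 0 1
  have hlim : ∫ r in (0 : ℝ)..1, deriv smoothStep r * Ψ (0 * r) = Φ 0 := by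
    simp only [zero_mul, hΨΦ (left_mem_Icc.2 hc.le), intervalIntegral.integral_mul_const,
      integral_deriv_smoothStep, one_mul]
  rw [← hlim]
  refine (hcont.continuousAt.tendsto.mono_left nhdsWithin_le_nhds).congr' ?_
  filter_upwards [Ioc_mem_nhdsGT hc] with b hb
  have hsubst := intervalIntegral.integral_comp_div (a := 0) (b := b)
    (fun r => b⁻¹ * deriv smoothStep r * Ψ (b * r)) hb.1.ne'
  simp only [mul_assoc, zero_div, div_self hb.1.ne', intervalIntegral.integral_const_mul,
    mul_div_cancel₀ _ hb.1.ne', smul_eq_mul, mul_inv_cancel_left₀ hb.1.ne'] at hsubst ⊢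
  rw [← hsubst]
  congr 1
  refine intervalIntegral.integral_congr fun s hs => ?_
  rw [uIcc_of_le hb.1.le] at hs
  simp only [hΨΦ ⟨hs.1, hs.2.trans hb.2⟩]

namespace SmoothObject

variable (B : SmoothObject) (F : Plane → Plane)

/-- The flux of a vector field out of an object. -/
def flux : ℝ := B.boundaryIntegral fun t => inner ℝ (F (B.curve t)) (B.outwardNormal t)

/-- The flux density of a vector field in the collar coordinates, through the curves of constant
depth. -/
def fluxDensity (y : Plane) : ℝ :=
  det2 (F (B.collarMap y)) (fderiv ℝ B.collarMap y (unitVec 0))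

/-- The flux of a vector field through the curve at depth `s` of the collar. -/
def layerFlux (s : ℝ) : ℝ := ∫ t in 0..2 * π, B.fluxDensity F (point t s)

lemma norm_deriv_smul_outwardNormal (t : ℝ) :
    ‖deriv B.curve t‖ • B.outwardNormal t = -perp (deriv B.curve t) := by
  rw [outwardNormal, smul_neg, smul_inv_smul₀ (norm_ne_zero_iff.2 (B.deriv_curve_ne_zero t))]

lemma layerFlux_zero : B.layerFlux F 0 = B.flux F := by
  rw [layerFlux, flux, boundaryIntegral]
  congr! 2 with t
  rw [smul_eq_mul, ← real_inner_smul_right, norm_deriv_smul_outwardNormal, fluxDensity,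
    fderiv_collarMap_apply, collarMap_point_zero, inner_eq, det2]
  simp only [unitVec, PiLp.single_eq_same, point_zero, point_one, zero_smul, sub_zero, one_smul,
    ne_eq, one_ne_zero, not_false_eq_true, PiLp.single_eq_of_ne, PiLp.neg_apply, perp_apply_zero,
    neg_neg, perp_apply_one, mul_neg]
  ring

end SmoothObject

namespace Suspension.IsCollarWidth

variable {N : ℕ} {S : Suspension N} {δ b : ℝ} {F : Plane → Plane}

lemma abs_lt_of_mem_collarBox (hbδ : b < δ) {y : Plane} (hy : y ∈ collarBox b) : |y 1| < δ := by
  rw [abs_of_pos hy.2.1]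
  exact hy.2.2.trans_lt hbδ

lemma injOn_collarBox (hδ : S.IsCollarWidth δ) (hbδ : b < δ) (i : Fin N) :
    InjOn (S.object i).collarMap (collarBox b) := fun y hy z hz h => by
  obtain ⟨-, -, k, hk⟩ := hδ.injective (ℓ := 0) (abs_lt_of_mem_collarBox hbδ hy)
    (abs_lt_of_mem_collarBox hbδ hz) (by simpa using h)
  have hk0 : k = 0 := by
    have hz0 := hz.1
    simp only [hk, PiLp.add_apply, PiLp.smul_apply, collarPeriod_zero, zsmul_eq_mul] at hz0
    have hpi := Real.two_pi_pos
    have hlt : (k : ℝ) < 1 := lt_of_mul_lt_mul_right (by linarith [hy.1.1, hz0.2]) hpi.le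
    have hgt : (-1 : ℝ) < k := lt_of_mul_lt_mul_right (by linarith [hy.1.2, hz0.1]) hpi.le
    norm_cast at hlt hgt
    omega
  rw [hk, hk0, zero_smul, add_zero]

lemma continuousOn_fluxDensity (hδ : S.IsCollarWidth δ) (hF : ContinuousOn F S.closedFluid)
    (i : Fin N) : ContinuousOn ((S.object i).fluxDensity F) (strip (Ico 0 δ)) := by
  have hF' : ContinuousOn (fun y => F ((S.object i).collarMap y)) (strip (Ico 0 δ)) :=
    hF.comp (S.object i).continuous_collarMap.continuousOn fun y hy =>
      hδ.collarMap_mem_closedFluid i hy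
  have hderiv : Continuous fun y => fderiv ℝ (S.object i).collarMap y (unitVec 0) :=
    ((S.object i).contDiff_collarMap.continuous_fderiv (by simp)).clm_apply continuous_const
  have hdet : Continuous fun q : Plane × Plane => det2 q.1 q.2 := by unfold det2; fun_prop
  exact hdet.comp_continuousOn (hF'.prodMk hderiv.continuousOn)

lemma continuousOn_layerFlux (hδ : S.IsCollarWidth δ) (hF : ContinuousOn F S.closedFluid)
    (i : Fin N) : ContinuousOn ((S.object i).layerFlux F) (Ico 0 δ) := by
  rw [continuousOn_iff_continuous_domRestrict]
  have hdensity : Continuous fun q : Ico 0 δ × ℝ => (S.object i).fluxDensity F (point q.2 q.1) :=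
    (hδ.continuousOn_fluxDensity hF i).comp_continuous (by fun_prop) fun q => by
      simpa only [mem_strip, point_one] using q.1.2
  exact intervalIntegral.continuous_parametric_intervalIntegral_of_continuous' hdensity 0 (2 * π)

lemma abs_det_smul_fderiv_cutoff (hδ : S.IsCollarWidth δ) (hb : 0 < b) (hbδ : b < δ) (i : Fin N)
    {y : Plane} (hy : |y 1| < δ) :
    |(fderiv ℝ (S.object i).collarMap y).det| •
        fderiv ℝ (S.cutoff δ b) ((S.object i).collarMap y) (F ((S.object i).collarMap y)) =
      b⁻¹ * deriv smoothStep (y 1 / b) * (S.object i).fluxDensity F y := by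
  have hneg : (fderiv ℝ (S.object i).collarMap y).det < 0 := hδ.jacobian_neg i y hy
  have hcramer := det2_mul_apply (fderiv ℝ (S.cutoff δ b) ((S.object i).collarMap y))
    (fderiv ℝ (S.object i).collarMap y (unitVec 0)) (fderiv ℝ (S.object i).collarMap y (unitVec 1))
    (F ((S.object i).collarMap y))
  rw [hδ.fderiv_cutoff_collarMap hb hbδ i hy, hδ.fderiv_cutoff_collarMap hb hbδ i hy,
    ← det_eq_det2] at hcramer
  rw [smul_eq_mul, abs_of_neg hneg, neg_mul, hcramer, SmoothObject.fluxDensity]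
  simp only [unitVec, ne_eq, one_ne_zero, not_false_eq_true, PiLp.single_eq_of_ne, mul_zero, det2,
    zero_mul, PiLp.single_eq_same, mul_one, zero_add]
  ring

lemma setIntegral_fderiv_cutoff (hδ : S.IsCollarWidth δ) (hb : 0 < b) (hbδ : b < δ)
    (hF : ContinuousOn F S.closedFluid) (i : Fin N) :
    ∫ x in (S.object i).collarMap '' collarBox b, fderiv ℝ (S.cutoff δ b) x (F x) =
      ∫ s in 0..b, b⁻¹ * deriv smoothStep (s / b) * (S.object i).layerFlux F s := by
  have hstep : Continuous (deriv smoothStep) :=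
    (contDiff_smoothStep (n := 1)).continuous_deriv (by simp)
  rw [integral_image_eq_integral_abs_det_fderiv_smul volume (measurableSet_collarBox b)
    (fun y _ => ((S.object i).differentiable_collarMap y).hasFDerivAt.hasFDerivWithinAt)
    (hδ.injOn_collarBox hbδ i), setIntegral_congr_fun (measurableSet_collarBox b) fun y hy =>
      hδ.abs_det_smul_fderiv_cutoff hb hbδ i (abs_lt_of_mem_collarBox hbδ hy),
    setIntegral_collarBox hb.le]
  · simp only [point_one, intervalIntegral.integral_const_mul, SmoothObject.layerFlux]
  · have hdensity : ContinuousOn (fun q : ℝ × ℝ => (S.object i).fluxDensity F (point q.2 q.1))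
        (Icc 0 b ×ˢ Icc 0 (2 * π)) :=
      (hδ.continuousOn_fluxDensity hF i).comp (by fun_prop) fun q hq => by
        simpa using ⟨hq.1.1, hq.1.2.trans_lt hbδ⟩
    simp only [point_one]
    fun_prop

end Suspension.IsCollarWidth

/-- The divergence of a plane vector field. -/
def divergence (F : Plane → Plane) (x : Plane) : ℝ := ∑ i, fderiv ℝ F x (unitVec i) i

lemma divergence_smul {f : Plane → ℝ} {F : Plane → Plane} {x : Plane}
    (hf : DifferentiableAt ℝ f x) (hF : DifferentiableAt ℝ F x) :
    divergence (fun y => f y • F y) x = fderiv ℝ f x (F x) + f x * divergence F x := by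
  have hexpand : fderiv ℝ f x (F x) =
      F x 0 * fderiv ℝ f x (unitVec 0) + F x 1 * fderiv ℝ f x (unitVec 1) := by
    conv_lhs => rw [eq_sum_unitVec (F x), map_add, map_smul, map_smul]
    rfl
  have hmul : HasFDerivAt (fun y => f y • F y) _ x := hf.hasFDerivAt.smul hF.hasFDerivAt
  rw [divergence, divergence, hmul.fderiv, hexpand]
  simp only [add_apply, smul_apply, ContinuousLinearMap.smulRight_apply, PiLp.add_apply,
    PiLp.smul_apply, smul_eq_mul, Fin.sum_univ_two]
  ring

lemma continuousOn_divergence {F : Plane → Plane} {U : Set Plane} (hU : IsOpen U)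
    (hF : ContDiffOn ℝ 1 F U) : ContinuousOn (divergence F) U := by
  have hderiv := hF.continuousOn_fderiv_of_isOpen hU le_rfl
  unfold divergence
  fun_prop

namespace Suspension

variable {N : ℕ} {S : Suspension N} {δ b : ℝ} {F : Plane → Plane}

lemma integral_cell_divergence (hF : ContDiff ℝ 1 F) (hper : S.IsPeriodic F) :
    ∫ x in S.cell, divergence F x = 0 := by
  have hcoord (i : Fin 2) : ContDiff ℝ 1 fun x => F x i := (contDiff_apply i).comp hF
  have hpartial (x : Plane) (i : Fin 2) :
      fderiv ℝ F x (unitVec i) i = fderiv ℝ (fun y => F y i) x (unitVec i) := by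
    have hcomp : HasFDerivAt (fun y => F y i) _ x :=
      (EuclideanSpace.proj i : Plane →L[ℝ] ℝ).hasFDerivAt.comp x
        (hF.differentiable one_ne_zero x).hasFDerivAt
    rw [hcomp.fderiv]
    rfl
  simp only [divergence, hpartial]
  rw [integral_finsetSum]
  · exact Finset.sum_eq_zero fun i _ =>
      integral_cell_fderiv (hcoord i) (fun x ℓ => congrArg (· i) (hper x ℓ)) _
  · exact fun i _ => integrableOn_of_continuous_of_isBounded
      (((hcoord i).continuous_fderiv one_ne_zero).clm_apply continuous_const) isBounded_cell

lemma isPeriodic_of_fluid {E : Type*} [Zero E] {g : Plane → E}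
    (hg : ∀ x ∈ S.fluid, ∀ ℓ : S.lattice, g (x + ℓ) = g x) (hzero : ∀ x ∉ S.fluid, g x = 0) :
    S.IsPeriodic g := fun x ℓ => by
  by_cases hx : x ∈ S.fluid
  · exact hg x hx ℓ
  · rw [hzero x hx, hzero _ ((add_mem_fluid ℓ).not.2 hx)]

namespace IsCollarWidth

lemma continuous_of_eventuallyEq_zero {g : Plane → ℝ} (hδ : S.IsCollarWidth δ)
    (hg : ContinuousOn g S.fluid) (hzero : ∀ x, S.depth δ x ≤ 0 → g =ᶠ[𝓝 x] 0) : Continuous g :=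
  continuous_iff_continuousAt.2 fun x => by
    rcases le_or_gt (S.depth δ x) 0 with hx | hx
    · exact continuousAt_const.congr_of_eventuallyEq (hzero x hx)
    · exact hg.continuousAt (isOpen_fluid.mem_nhds (hδ.depth_pos_iff.1 hx))

lemma isPeriodic_cutoff (hδ : S.IsCollarWidth δ) : S.IsPeriodic (S.cutoff δ b) := fun x ℓ => by
  rw [cutoff, cutoff, hδ.depth_add]

lemma depth_nonpos (hδ : S.IsCollarWidth δ) {x : Plane} (hx : x ∉ S.fluid) : S.depth δ x ≤ 0 :=
  not_lt.1 (hδ.depth_pos_iff.not.2 hx)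

lemma cutoff_eq_zero_of_notMem_fluid (hδ : S.IsCollarWidth δ) (hb : 0 < b) {x : Plane}
    (hx : x ∉ S.fluid) : S.cutoff δ b x = 0 :=
  cutoff_eq_zero hb ((hδ.depth_nonpos hx).trans (half_pos hb).le)

lemma continuous_fderiv_cutoff_apply (hδ : S.IsCollarWidth δ) (hb : 0 < b) (hbδ : b < δ)
    (hF : ContinuousOn F S.fluid) : Continuous fun x => fderiv ℝ (S.cutoff δ b) x (F x) := by
  refine hδ.continuous_of_eventuallyEq_zero ?_ fun x hx => ?_
  · exact ((hδ.contDiff_cutoff hb hbδ).continuous_fderiv (by simp)).continuousOn.clm_apply hF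
  · filter_upwards [(hδ.cutoff_eventuallyEq_zero hb hx).fderiv (𝕜 := ℝ)] with z hz
    simp [hz]

lemma isPeriodic_fderiv_cutoff_apply (hδ : S.IsCollarWidth δ) (hb : 0 < b)
    (hper : ∀ x ∈ S.closedFluid, ∀ ℓ : S.lattice, F (x + ℓ) = F x) :
    S.IsPeriodic fun x => fderiv ℝ (S.cutoff δ b) x (F x) :=
  isPeriodic_of_fluid
    (fun x hx ℓ => by rw [hδ.isPeriodic_cutoff.fderiv, hper x (fluid_subset_closedFluid hx)])
    fun x hx => by simp [(hδ.cutoff_eventuallyEq_zero hb (hδ.depth_nonpos hx)).fderiv_eq]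

lemma contDiff_cutoff_smul (hδ : S.IsCollarWidth δ) (hb : 0 < b) (hbδ : b < δ)
    (hF : ContDiffOn ℝ 1 F S.fluid) : ContDiff ℝ 1 fun x => S.cutoff δ b x • F x :=
  contDiff_iff_contDiffAt.2 fun x => by
    rcases le_or_gt (S.depth δ x) 0 with hx | hx
    · refine contDiffAt_const (c := 0) |>.congr_of_eventuallyEq ?_
      filter_upwards [hδ.cutoff_eventuallyEq_zero hb hx] with z hz
      simp [hz]
    · exact ((hδ.contDiff_cutoff hb hbδ).contDiffAt.of_le (by simp)).smul
        (hF.contDiffAt (isOpen_fluid.mem_nhds (hδ.depth_pos_iff.1 hx)))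

lemma isPeriodic_cutoff_smul (hδ : S.IsCollarWidth δ) (hb : 0 < b)
    (hper : ∀ x ∈ S.closedFluid, ∀ ℓ : S.lattice, F (x + ℓ) = F x) :
    S.IsPeriodic fun x => S.cutoff δ b x • F x :=
  isPeriodic_of_fluid
    (fun x hx ℓ => by rw [hδ.isPeriodic_cutoff, hper x (fluid_subset_closedFluid hx)])
    fun x hx => by rw [hδ.cutoff_eq_zero_of_notMem_fluid hb hx, zero_smul]

lemma continuous_cutoff_mul_divergence (hδ : S.IsCollarWidth δ) (hb : 0 < b) (hbδ : b < δ)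
    (hF : ContDiffOn ℝ 1 F S.fluid) : Continuous fun x => S.cutoff δ b x * divergence F x := by
  refine hδ.continuous_of_eventuallyEq_zero ?_ fun x hx => ?_
  · exact (hδ.contDiff_cutoff hb hbδ).continuous.continuousOn.mul
      (continuousOn_divergence isOpen_fluid hF)
  · filter_upwards [hδ.cutoff_eventuallyEq_zero hb hx] with z hz
    simp [hz]

lemma isPeriodic_cutoff_mul_divergence (hδ : S.IsCollarWidth δ) (hb : 0 < b)
    (hper : ∀ x ∈ S.closedFluid, ∀ ℓ : S.lattice, F (x + ℓ) = F x) :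
    S.IsPeriodic fun x => S.cutoff δ b x * divergence F x := by
  refine isPeriodic_of_fluid (fun x hx ℓ => ?_)
    fun x hx => by rw [hδ.cutoff_eq_zero_of_notMem_fluid hb hx, zero_mul]
  have heq : (fun y => F (y + ℓ)) =ᶠ[𝓝 x] F := by
    filter_upwards [isOpen_fluid.mem_nhds hx] with y hy
    exact hper y (fluid_subset_closedFluid hy) ℓ
  rw [hδ.isPeriodic_cutoff, divergence, divergence, ← fderiv_comp_add_right, heq.fderiv_eq]

lemma divergence_cutoff_smul (hδ : S.IsCollarWidth δ) (hb : 0 < b) (hbδ : b < δ)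
    (hF : ContDiffOn ℝ 1 F S.fluid) (x : Plane) :
    divergence (fun y => S.cutoff δ b y • F y) x =
      fderiv ℝ (S.cutoff δ b) x (F x) + S.cutoff δ b x * divergence F x := by
  rcases le_or_gt (S.depth δ x) 0 with hx | hx
  · have hzero := hδ.cutoff_eventuallyEq_zero hb hx
    have hzero' : (fun y => S.cutoff δ b y • F y) =ᶠ[𝓝 x] 0 := by
      filter_upwards [hzero] with z hz
      simp [hz]
    simp [divergence, hzero.fderiv_eq, hzero'.fderiv_eq, hzero.eq_of_nhds]
  · exact divergence_smul ((hδ.contDiff_cutoff hb hbδ).differentiable (by simp) x)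
      ((hF.contDiffAt (isOpen_fluid.mem_nhds (hδ.depth_pos_iff.1 hx))).differentiableAt one_ne_zero)

lemma integral_cell_cutoff_mul_divergence (hδ : S.IsCollarWidth δ) (hb : 0 < b) (hbδ : b < δ)
    (hF : ContDiffOn ℝ 1 F S.fluid)
    (hper : ∀ x ∈ S.closedFluid, ∀ ℓ : S.lattice, F (x + ℓ) = F x) :
    ∫ x in S.cell, S.cutoff δ b x * divergence F x =
      -∫ x in S.cell, fderiv ℝ (S.cutoff δ b) x (F x) := by
  have htotal := integral_cell_divergence (hδ.contDiff_cutoff_smul hb hbδ hF)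
    (hδ.isPeriodic_cutoff_smul hb hper)
  simp only [hδ.divergence_cutoff_smul hb hbδ hF] at htotal
  rw [integral_add
    (integrableOn_of_continuous_of_isBounded
      (hδ.continuous_fderiv_cutoff_apply hb hbδ hF.continuousOn) isBounded_cell)
    (integrableOn_of_continuous_of_isBounded
      (hδ.continuous_cutoff_mul_divergence hb hbδ hF) isBounded_cell)] at htotal
  exact eq_neg_of_add_eq_zero_right htotal

lemma support_fderiv_cutoff_subset (hδ : S.IsCollarWidth δ) (hb : 0 < b) (hbδ : b < δ) :
    Function.support (fderiv ℝ (S.cutoff δ b)) ⊆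
      ⋃ ℓ : S.lattice, ℓ +ᵥ ⋃ i, (S.object i).collarMap '' collarBox b := fun x hx => by
  have hdepth : S.depth δ x ∈ Ioc 0 b := by
    by_contra h
    exact hx (hδ.fderiv_cutoff_eq_zero hb h)
  obtain ⟨y, hy, i, ℓ, hxy⟩ := hδ.exists_isCollarCoord
    (abs_lt.2 ⟨by linarith [hdepth.1, hδ.pos], hdepth.2.trans_lt hbδ⟩)
  rw [hδ.depth_eq hy ⟨i, ℓ, hxy⟩] at hdepth
  obtain ⟨t, ht, k, hk⟩ := exists_eq_point_add_period y
  rw [hk, (S.object i).periodic_collarMap.zsmul] at hxy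
  refine mem_iUnion.2 ⟨-ℓ, mem_vadd_set_iff_neg_vadd_mem.2 (mem_iUnion.2 ⟨i, ?_⟩)⟩
  refine ⟨point t (y 1), ⟨by simpa using ht, by simpa using hdepth⟩, ?_⟩
  rw [← hxy, neg_neg, Submodule.vadd_def, vadd_eq_add, add_comm]

lemma eq_of_mem_vadd_collarBox (hδ : S.IsCollarWidth δ) (hbδ : b < δ) {i j : Fin N}
    {ℓ ℓ' : S.lattice} {x : Plane} (hx : x ∈ ℓ +ᵥ (S.object i).collarMap '' collarBox b)
    (hx' : x ∈ ℓ' +ᵥ (S.object j).collarMap '' collarBox b) : i = j ∧ ℓ = ℓ' := by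
  obtain ⟨_, ⟨y, hy, rfl⟩, hxy⟩ := hx
  obtain ⟨_, ⟨z, hz, rfl⟩, hxz⟩ := hx'
  obtain ⟨hij, hℓ, -⟩ := hδ.injective (i := i) (j := j) (ℓ := ℓ - ℓ')
    (abs_lt_of_mem_collarBox hbδ hy) (abs_lt_of_mem_collarBox hbδ hz) (by
      have h := hxy.trans hxz.symm
      simp only [vadd_eq_add] at h
      rw [AddSubgroupClass.coe_sub, ← add_sub_assoc, add_comm, h, add_sub_cancel_left])
  exact ⟨hij, sub_eq_zero.1 hℓ⟩

lemma integral_cell_fderiv_cutoff (hδ : S.IsCollarWidth δ) (hb : 0 < b) (hbδ : b < δ)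
    (hF : ContinuousOn F S.closedFluid)
    (hper : ∀ x ∈ S.closedFluid, ∀ ℓ : S.lattice, F (x + ℓ) = F x) :
    ∫ x in S.cell, fderiv ℝ (S.cutoff δ b) x (F x) =
      ∑ i, ∫ s in 0..b, b⁻¹ * deriv smoothStep (s / b) * (S.object i).layerFlux F s := by
  let A (i : Fin N) : Set Plane := (S.object i).collarMap '' collarBox b
  have hmeas (i : Fin N) : MeasurableSet (A i) :=
    (measurableSet_collarBox b).image_of_continuousOn_injOn
      (S.object i).continuous_collarMap.continuousOn (hδ.injOn_collarBox hbδ i)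
  have hbdd (i : Fin N) : Bornology.IsBounded (A i) :=
    ((isBounded_collarBox b).isCompact_closure.image
      (S.object i).continuous_collarMap).isBounded.subset (image_mono subset_closure)
  have hint {D : Set Plane} (hD : Bornology.IsBounded D) :
      IntegrableOn (fun x => fderiv ℝ (S.cutoff δ b) x (F x)) D :=
    integrableOn_of_continuous_of_isBounded
      (hδ.continuous_fderiv_cutoff_apply hb hbδ (hF.mono fluid_subset_closedFluid)) hD
  have hdisj : Pairwise (Function.onFun Disjoint fun ℓ : S.lattice => ℓ +ᵥ ⋃ i, A i) := by
    refine fun ℓ ℓ' hne => disjoint_left.2 fun x hx hx' => hne ?_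
    simp only [vadd_set_iUnion, mem_iUnion] at hx hx'
    obtain ⟨i, hi⟩ := hx
    obtain ⟨j, hj⟩ := hx'
    exact (hδ.eq_of_mem_vadd_collarBox hbδ hi hj).2
  have hdisjA : Pairwise (Function.onFun Disjoint A) :=
    fun i j hne => disjoint_left.2 fun x hx hx' => hne
      (hδ.eq_of_mem_vadd_collarBox hbδ (ℓ := 0) (ℓ' := 0) (by rwa [zero_vadd])
        (by rwa [zero_vadd])).1
  have hsupp : Function.support (fun x => fderiv ℝ (S.cutoff δ b) x (F x)) ⊆
      ⋃ ℓ : S.lattice, ℓ +ᵥ ⋃ i, A i :=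
    fun x hx => hδ.support_fderiv_cutoff_subset hb hbδ fun h =>
      hx (by simp only [h, zero_apply])
  rw [setIntegral_fundamentalDomain_eq isAddFundamentalDomain_cell (MeasurableSet.iUnion hmeas)
    (hint isBounded_cell) (hint (Bornology.isBounded_iUnion.2 hbdd))
    (hδ.isPeriodic_fderiv_cutoff_apply hb hper).vadd hdisj hsupp,
    integral_iUnion_fintype hmeas hdisjA fun i => hint (hbdd i)]
  exact Finset.sum_congr rfl fun i _ => hδ.setIntegral_fderiv_cutoff hb hbδ hF i

theorem tendsto_integral_fderiv_cutoff (hδ : S.IsCollarWidth δ)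
    (hF : ContinuousOn F S.closedFluid)
    (hper : ∀ x ∈ S.closedFluid, ∀ ℓ : S.lattice, F (x + ℓ) = F x) :
    Tendsto (fun b => ∫ x in S.cell, fderiv ℝ (S.cutoff δ b) x (F x)) (𝓝[>] 0)
      (𝓝 (∑ i, (S.object i).flux F)) := by
  have hlayer (i : Fin N) := tendsto_integral_deriv_smoothStep (half_pos hδ.pos)
    ((hδ.continuousOn_layerFlux hF i).mono (Icc_subset_Ico_right (half_lt_self hδ.pos)))
  simp only [SmoothObject.layerFlux_zero] at hlayer
  refine (tendsto_finsetSum _ fun i _ => hlayer i).congr' ?_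
  filter_upwards [Ioo_mem_nhdsGT hδ.pos] with b hb
  exact (hδ.integral_cell_fderiv_cutoff hb.1 hb.2 hF hper).symm

lemma cutoff_mul_divergence_anti (hδ : S.IsCollarWidth δ) (hb : 0 < b) {c : ℝ} (hbc : b ≤ c)
    (hdiv : ∀ x ∈ S.fluid, 0 ≤ divergence F x) (x : Plane) :
    S.cutoff δ c x * divergence F x ≤ S.cutoff δ b x * divergence F x := by
  by_cases hx : x ∈ S.fluid
  · exact mul_le_mul_of_nonneg_right (cutoff_anti hb hbc x) (hdiv x hx)
  · rw [hδ.cutoff_eq_zero_of_notMem_fluid hb hx,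
      hδ.cutoff_eq_zero_of_notMem_fluid (hb.trans_le hbc) hx]

lemma integral_cell_cutoff_mul_divergence_le (hδ : S.IsCollarWidth δ) (hb : 0 < b) (hbδ : b < δ)
    (hF : ContDiffOn ℝ 1 F S.fluid) (hcont : ContinuousOn F S.closedFluid)
    (hper : ∀ x ∈ S.closedFluid, ∀ ℓ : S.lattice, F (x + ℓ) = F x)
    (hdiv : ∀ x ∈ S.fluid, 0 ≤ divergence F x) :
    ∫ x in S.cell, S.cutoff δ b x * divergence F x ≤ -∑ i, (S.object i).flux F := by
  refine ge_of_tendsto (hδ.tendsto_integral_fderiv_cutoff hcont hper).neg ?_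
  filter_upwards [Ioc_mem_nhdsGT hb] with c hc
  have hcδ : c < δ := hc.2.trans_lt hbδ
  rw [← hδ.integral_cell_cutoff_mul_divergence hc.1 hcδ hF hper]
  exact integral_mono
    (integrableOn_of_continuous_of_isBounded
      (hδ.continuous_cutoff_mul_divergence hb hbδ hF) isBounded_cell)
    (integrableOn_of_continuous_of_isBounded
      (hδ.continuous_cutoff_mul_divergence hc.1 hcδ hF) isBounded_cell)
    (hδ.cutoff_mul_divergence_anti hc.1 hc.2 hdiv)

end IsCollarWidth

theorem divergence_eq_zero_of_flux_nonneg (hF : ContDiffOn ℝ 1 F S.fluid)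
    (hcont : ContinuousOn F S.closedFluid)
    (hper : ∀ x ∈ S.closedFluid, ∀ ℓ : S.lattice, F (x + ℓ) = F x)
    (hdiv : ∀ x ∈ S.fluid, 0 ≤ divergence F x) (hflux : 0 ≤ ∑ i, (S.object i).flux F)
    {x : Plane} (hx : x ∈ S.fluid) : divergence F x = 0 := by
  obtain ⟨δ, hδ⟩ := S.exists_isCollarWidth
  have hpos : 0 < S.depth δ x := hδ.depth_pos_iff.2 hx
  obtain ⟨b, ⟨hb, hbδ⟩, hbx⟩ : ∃ b ∈ Ioo 0 δ, b ≤ S.depth δ x :=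
    ⟨min (S.depth δ x) (δ / 2), ⟨lt_min hpos (half_pos hδ.pos),
      (min_le_right _ _).trans_lt (half_lt_self hδ.pos)⟩, min_le_left _ _⟩
  have hnonneg (y : Plane) : 0 ≤ S.cutoff δ b y * divergence F y := by
    by_cases hy : y ∈ S.fluid
    · exact mul_nonneg (cutoff_nonneg y) (hdiv y hy)
    · rw [hδ.cutoff_eq_zero_of_notMem_fluid hb hy, zero_mul]
  have hzero := congrFun (eq_zero_of_integral_cell_nonpos
    (hδ.continuous_cutoff_mul_divergence hb hbδ hF)
    (hδ.isPeriodic_cutoff_mul_divergence hb hper) hnonneg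
    ((hδ.integral_cell_cutoff_mul_divergence_le hb hbδ hF hcont hper hdiv).trans
      (neg_nonpos.2 hflux))) x
  rwa [cutoff_eq_one hb hbx, one_mul] at hzero

end Suspension

lemma divergence_eq_sum_fderiv_coord {F : Plane → Plane} {x : Plane}
    (hF : DifferentiableAt ℝ F x) :
    divergence F x = ∑ j, fderiv ℝ (fun y => F y j) x (unitVec j) := by
  refine Finset.sum_congr rfl fun j _ => ?_
  have hcoord : HasFDerivAt (fun y => F y j) _ x :=
    (EuclideanSpace.proj j : Plane →L[ℝ] ℝ).hasFDerivAt.comp x hF.hasFDerivAt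
  rw [hcoord.fderiv]
  rfl

lemma gradient_apply (f : Plane → ℝ) (x : Plane) (i : Fin 2) :
    gradient f x i = fderiv ℝ f x (unitVec i) := by
  rw [← InnerProductSpace.toDual_symm_apply, EuclideanSpace.inner_single_right, gradient]
  simp

lemma laplacian_apply (u : Plane → Plane) (x : Plane) (i : Fin 2) :
    Laplacian.laplacian u x i = ∑ j, fderiv ℝ (fderiv ℝ u) x (unitVec j) (unitVec j) i := by
  rw [congrFun (InnerProductSpace.laplacian_eq_iteratedFDeriv_orthonormalBasis u
    (EuclideanSpace.basisFun (Fin 2) ℝ)) x]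
  simp [iteratedFDeriv_two_apply]

/-- A trilinear form that is symmetric in its first two arguments and skew in its last two
vanishes. -/
lemma fderiv_fderiv_eq_zero_of_skew {E : Type*} [NormedAddCommGroup E] [InnerProductSpace ℝ E]
    {u : E → E} {x : E} (hu : ContDiffAt ℝ 2 u x)
    (hskew : ∀ᶠ y in 𝓝 x, ∀ a b, inner ℝ (fderiv ℝ u y a) b + inner ℝ (fderiv ℝ u y b) a = 0) :
    fderiv ℝ (fderiv ℝ u) x = 0 := by
  have hsymm a b : fderiv ℝ (fderiv ℝ u) x a b = fderiv ℝ (fderiv ℝ u) x b a :=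
    (hu.isSymmSndFDerivAt (by simp)).eq a b
  have hD : HasFDerivAt (fderiv ℝ u) (fderiv ℝ (fderiv ℝ u) x) x :=
    ((hu.fderiv_right (m := 1) (by norm_num)).differentiableAt one_ne_zero).hasFDerivAt
  have hskew' a b c : inner ℝ (fderiv ℝ (fderiv ℝ u) x c a) b +
      inner ℝ (fderiv ℝ (fderiv ℝ u) x c b) a = 0 := by
    have hpair (a b : E) := (hD.clm_apply (hasFDerivAt_const a x)).inner ℝ (hasFDerivAt_const b x)
    have h := ((hpair a b).fun_add (hpair b a)).unique ((hasFDerivAt_const (0 : ℝ) x)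
      |>.congr_of_eventuallyEq (hskew.mono fun y hy => hy a b))
    simpa using DFunLike.congr_fun h c
  ext a b
  refine ext_inner_right ℝ fun c => ?_
  rw [zero_apply, zero_apply, inner_zero_left]
  linarith [hskew' b c a, hskew' c a b, hskew' a b c, congrArg (inner ℝ · c) (hsymm a b),
    congrArg (inner ℝ · a) (hsymm b c), congrArg (inner ℝ · b) (hsymm c a)]

lemma stress_apply (μ : ℝ) (D : Set Plane) (u : Plane → Plane) (p : Plane → ℝ) (x : Plane)
    (i j : Fin 2) : stress μ D u p x i j =
      -(if i = j then p x else 0) + μ * (partialWithin D u x i j + partialWithin D u x j i) :=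
  rfl

lemma traction_apply (μ : ℝ) (D : Set Plane) (u : Plane → Plane) (p : Plane → ℝ) (x n : Plane)
    (i : Fin 2) : traction μ D u p x n i = ∑ j, stress μ D u p x i j * n j :=
  rfl

lemma inner_traction (μ : ℝ) (D : Set Plane) (u : Plane → Plane) (p : Plane → ℝ) (x a b : Plane) :
    inner ℝ (traction μ D u p x a) b = inner ℝ a (traction μ D u p x b) := by
  simp only [inner_eq, traction_apply, Fin.sum_univ_two, stress_apply]
  simp only [zero_ne_one, one_ne_zero, if_false, add_comm (partialWithin D u x 1 0)]
  ring

namespace Suspension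

variable {N : ℕ} {S : Suspension N} {u : Plane → Plane}

lemma closedFluid_mem_nhds {x : Plane} (hx : x ∈ S.fluid) : S.closedFluid ∈ 𝓝 x :=
  mem_of_superset (isOpen_fluid.mem_nhds hx) fluid_subset_closedFluid

lemma fderivWithin_eq_fderiv {x : Plane} (hx : x ∈ S.fluid) :
    fderivWithin ℝ u S.closedFluid x = fderiv ℝ u x :=
  fderivWithin_of_mem_nhds (closedFluid_mem_nhds hx)

lemma fderivWithin_eventuallyEq {x : Plane} (hx : x ∈ S.fluid) :
    fderivWithin ℝ u S.closedFluid =ᶠ[𝓝 x] fderiv ℝ u :=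
  eventually_of_mem (isOpen_fluid.mem_nhds hx) fun _ => fderivWithin_eq_fderiv

lemma fderivWithin_add_lattice {E : Type*} [NormedAddCommGroup E] [NormedSpace ℝ E] {f : Plane → E}
    (hf : ∀ x ∈ S.closedFluid, ∀ ℓ : S.lattice, f (x + ℓ) = f x) {x : Plane}
    (hx : x ∈ S.closedFluid) (ℓ : S.lattice) :
    fderivWithin ℝ f S.closedFluid (x + ℓ) = fderivWithin ℝ f S.closedFluid x := by
  have hinv : (ℓ : Plane) +ᵥ S.closedFluid = S.closedFluid := by
    ext y
    rw [mem_vadd_set_iff_neg_vadd_mem, vadd_eq_add, add_comm, ← NegMemClass.coe_neg,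
      add_mem_closedFluid]
  have hshift := fderivWithin_comp_add_right (𝕜 := ℝ) (f := f) (s := S.closedFluid) (x := x)
    (ℓ : Plane)
  rw [hinv] at hshift
  rw [← hshift]
  exact fderivWithin_congr (fun y hy => hf y hy ℓ) (hf x hx ℓ)

lemma eq_of_fderiv_eq_zero {E : Type*} [NormedAddCommGroup E] [NormedSpace ℝ E] {f : Plane → E}
    (hf : DifferentiableOn ℝ f S.fluid) (hcont : ContinuousOn f S.closedFluid)
    (hzero : ∀ x ∈ S.fluid, fderiv ℝ f x = 0) {x y : Plane} (hx : x ∈ S.closedFluid)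
    (hy : y ∈ S.closedFluid) : f x = f y := by
  obtain ⟨c, hc⟩ :=
    isOpen_fluid.exists_is_const_of_fderiv_eq_zero isPreconnected_fluid hf hzero
  have hconst : EqOn f (fun _ => c) S.closedFluid :=
    EqOn.of_subset_closure hc hcont continuousOn_const fluid_subset_closedFluid
      closedFluid_subset_closure_fluid
  rw [hconst hx, hconst hy]

end Suspension

namespace IsMobilitySolution

open Suspension

variable {N : ℕ} {S : Suspension N} {μ : ℝ} {u₀ u : Plane → Plane} {p : Plane → ℝ}
  {v : Fin N → Plane} {ω : Fin N → ℝ}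

lemma velocity_add (h : IsMobilitySolution S μ u₀ u p v ω) :
    ∀ x ∈ S.closedFluid, ∀ ℓ : S.lattice, u (x + ℓ) = u x := fun x hx ℓ => by
  obtain ⟨m₁, m₂, hm⟩ := mem_lattice.1 ℓ.2
  rw [← hm, h.periodic_velocity x hx]

lemma pressure_add (h : IsMobilitySolution S μ u₀ u p v ω) :
    ∀ x ∈ S.closedFluid, ∀ ℓ : S.lattice, p (x + ℓ) = p x := fun x hx ℓ => by
  obtain ⟨m₁, m₂, hm⟩ := mem_lattice.1 ℓ.2
  rw [← hm, h.periodic_pressure x hx]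

section Interior

variable {x : Plane}

lemma contDiffAt_velocity (h : IsMobilitySolution S μ u₀ u p v ω) (hx : x ∈ S.fluid) :
    ContDiffAt ℝ 2 u x :=
  h.contDiffOn_velocity.contDiffAt (isOpen_fluid.mem_nhds hx)

lemma contDiffAt_pressure (h : IsMobilitySolution S μ u₀ u p v ω) (hx : x ∈ S.fluid) :
    ContDiffAt ℝ 1 p x :=
  h.contDiffOn_pressure.contDiffAt (isOpen_fluid.mem_nhds hx)

lemma contDiffAt_fderivWithin (h : IsMobilitySolution S μ u₀ u p v ω) (hx : x ∈ S.fluid) :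
    ContDiffAt ℝ 1 (fderivWithin ℝ u S.closedFluid) x :=
  ((h.contDiffAt_velocity hx).fderiv_right (m := 1) (by norm_num)).congr_of_eventuallyEq
    (fderivWithin_eventuallyEq hx)

lemma contDiffAt_partialWithin (h : IsMobilitySolution S μ u₀ u p v ω) (hx : x ∈ S.fluid)
    (i j : Fin 2) : ContDiffAt ℝ 1 (fun y => partialWithin S.closedFluid u y i j) x :=
  (contDiff_apply i).contDiffAt.comp x
    ((h.contDiffAt_fderivWithin hx).clm_apply contDiffAt_const)

lemma contDiffAt_stress (h : IsMobilitySolution S μ u₀ u p v ω) (hx : x ∈ S.fluid)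
    (i j : Fin 2) : ContDiffAt ℝ 1 (fun y => stress μ S.closedFluid u p y i j) x := by
  have hp := h.contDiffAt_pressure hx
  have hgrad := h.contDiffAt_partialWithin hx
  simp only [stress_apply]
  split_ifs <;> fun_prop (disch := assumption)

lemma sum_partialWithin_eq_zero (h : IsMobilitySolution S μ u₀ u p v ω) (hx : x ∈ S.fluid) :
    ∑ i, partialWithin S.closedFluid u x i i = 0 := by
  simp only [partialWithin, fderivWithin_eq_fderiv hx, h.incompressible x hx]

lemma fderiv_partialWithin (h : IsMobilitySolution S μ u₀ u p v ω) (hx : x ∈ S.fluid)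
    (i j : Fin 2) (a : Plane) : fderiv ℝ (fun y => partialWithin S.closedFluid u y i j) x a =
      fderiv ℝ (fderiv ℝ u) x a (unitVec j) i := by
  have hgrad : HasFDerivAt (fderivWithin ℝ u S.closedFluid) (fderiv ℝ (fderiv ℝ u) x) x := by
    rw [← (fderivWithin_eventuallyEq hx).fderiv_eq]
    exact ((h.contDiffAt_fderivWithin hx).differentiableAt one_ne_zero).hasFDerivAt
  have hpartial : HasFDerivAt (fun y => partialWithin S.closedFluid u y i j) _ x :=
    (EuclideanSpace.proj i : Plane →L[ℝ] ℝ).hasFDerivAt.comp x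
      (hgrad.clm_apply (hasFDerivAt_const (unitVec j) x))
  rw [hpartial.fderiv]
  simp

lemma sum_fderiv_fderiv_eq_zero (h : IsMobilitySolution S μ u₀ u p v ω) (hx : x ∈ S.fluid)
    (a : Plane) : ∑ i, fderiv ℝ (fderiv ℝ u) x a (unitVec i) i = 0 := by
  have hdiv : (fun y => ∑ i, partialWithin S.closedFluid u y i i) =ᶠ[𝓝 x] fun _ => (0 : ℝ) :=
    eventually_of_mem (isOpen_fluid.mem_nhds hx) fun _ hy => h.sum_partialWithin_eq_zero hy
  have hdiff i (_ : i ∈ Finset.univ) :=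
    (h.contDiffAt_partialWithin hx i i).differentiableAt one_ne_zero
  have hderiv := hdiv.fderiv_eq (𝕜 := ℝ)
  rw [fderiv_fun_sum hdiff, fderiv_fun_const] at hderiv
  simpa [h.fderiv_partialWithin hx] using DFunLike.congr_fun hderiv a

lemma fderiv_pressure (h : IsMobilitySolution S μ u₀ u p v ω) (hx : x ∈ S.fluid) (i : Fin 2) :
    fderiv ℝ p x (unitVec i) =
      μ * ∑ j, fderiv ℝ (fderiv ℝ u) x (unitVec j) (unitVec j) i := by
  rw [← gradient_apply, ← laplacian_apply, ← sub_eq_zero, sub_eq_neg_add]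
  exact congrArg (· i) (h.stokes x hx)

lemma fderiv_stress (h : IsMobilitySolution S μ u₀ u p v ω) (hx : x ∈ S.fluid) (i j : Fin 2)
    (a : Plane) : fderiv ℝ (fun y => stress μ S.closedFluid u p y i j) x a =
      -(if i = j then fderiv ℝ p x a else 0) + μ * (fderiv ℝ (fderiv ℝ u) x a (unitVec j) i +
        fderiv ℝ (fderiv ℝ u) x a (unitVec i) j) := by
  have hp := (h.contDiffAt_pressure hx).differentiableAt one_ne_zero
  have hgrad i j := (h.contDiffAt_partialWithin hx i j).differentiableAt one_ne_zero
  have hvisc := ((hgrad i j).fun_add (hgrad j i)).const_mul μ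
  have hpress : HasFDerivAt (fun y => -(if i = j then p y else 0))
      (-(if i = j then fderiv ℝ p x else 0)) x := by
    split_ifs
    exacts [hp.hasFDerivAt.fun_neg, (hasFDerivAt_const (0 : ℝ) x).fun_neg]
  simp only [stress_apply]
  rw [fderiv_fun_add hpress.differentiableAt hvisc, hpress.fderiv,
    fderiv_const_mul ((hgrad i j).fun_add (hgrad j i)), fderiv_fun_add (hgrad i j) (hgrad j i)]
  simp only [add_apply, smul_apply, neg_apply, smul_eq_mul, h.fderiv_partialWithin hx]
  split_ifs <;> simp

lemma sum_fderiv_stress_eq_zero (h : IsMobilitySolution S μ u₀ u p v ω) (hx : x ∈ S.fluid)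
    (i : Fin 2) : ∑ j, fderiv ℝ (fun y => stress μ S.closedFluid u p y j i) x (unitVec j) = 0 := by
  have hsymm (a b : Plane) : fderiv ℝ (fderiv ℝ u) x a b = fderiv ℝ (fderiv ℝ u) x b a :=
    ((h.contDiffAt_velocity hx).isSymmSndFDerivAt (by simp)).eq a b
  have hdiv := h.sum_fderiv_fderiv_eq_zero hx (unitVec i)
  simp only [h.fderiv_stress hx, Finset.sum_add_distrib, Finset.sum_neg_distrib, ← Finset.mul_sum,
    Finset.sum_ite_eq', Finset.mem_univ, if_true, h.fderiv_pressure hx, hsymm _ (unitVec i), hdiv]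
  ring

end Interior

end IsMobilitySolution

namespace SmoothObject

variable {B : SmoothObject} {E : Type*} [NormedAddCommGroup E] [NormedSpace ℝ E] {f g : ℝ → E}

lemma continuous_outwardNormal : Continuous B.outwardNormal :=
  ((B.contDiff_deriv_curve.continuous.norm.inv₀ fun t =>
    norm_ne_zero_iff.2 (B.deriv_curve_ne_zero t)).smul
      (perpCLM.continuous.comp B.contDiff_deriv_curve.continuous)).neg

lemma intervalIntegrable_boundaryIntegrand (hf : Continuous f) :
    IntervalIntegrable (fun t => ‖deriv B.curve t‖ • f t) volume 0 (2 * π) :=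
  (B.contDiff_deriv_curve.continuous.norm.smul hf).intervalIntegrable _ _

lemma boundaryIntegral_add (hf : Continuous f) (hg : Continuous g) :
    B.boundaryIntegral (fun t => f t + g t) = B.boundaryIntegral f + B.boundaryIntegral g := by
  simp only [boundaryIntegral, smul_add]
  exact intervalIntegral.integral_add (intervalIntegrable_boundaryIntegrand hf)
    (intervalIntegrable_boundaryIntegrand hg)

lemma boundaryIntegral_clm_apply {G : Type*} [NormedAddCommGroup G] [NormedSpace ℝ G]
    [CompleteSpace E] [CompleteSpace G] (L : E →L[ℝ] G) (hf : Continuous f) :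
    B.boundaryIntegral (fun t => L (f t)) = L (B.boundaryIntegral f) := by
  simp only [boundaryIntegral, ← map_smul]
  exact L.intervalIntegral_comp_comm (intervalIntegrable_boundaryIntegrand hf)

end SmoothObject

/-- The rate of work `σ u` of the stress, whose flux through a curve is the power that is
transmitted through it. -/
def power (μ : ℝ) (D : Set Plane) (u : Plane → Plane) (p : Plane → ℝ) (x : Plane) : Plane :=
  traction μ D u p x (u x)

/-- The viscous dissipation `(μ / 2) ∑ᵢⱼ (∂ⱼ uᵢ + ∂ᵢ uⱼ) ²` of a flow. -/
def dissipation (μ : ℝ) (D : Set Plane) (u : Plane → Plane) (x : Plane) : ℝ :=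
  μ / 2 * ∑ i, ∑ j, (partialWithin D u x i j + partialWithin D u x j i) ^ 2

lemma power_apply (μ : ℝ) (D : Set Plane) (u : Plane → Plane) (p : Plane → ℝ) (x : Plane)
    (i : Fin 2) : power μ D u p x i = ∑ j, stress μ D u p x i j * u x j :=
  rfl

lemma dissipation_nonneg {μ : ℝ} (hμ : 0 ≤ μ) (D : Set Plane) (u : Plane → Plane) (x : Plane) :
    0 ≤ dissipation μ D u x := by
  unfold dissipation; positivity

lemma partialWithin_add_eq_zero_of_dissipation_eq_zero {μ : ℝ} (hμ : μ ≠ 0) {D : Set Plane}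
    {u : Plane → Plane} {x : Plane} (hx : dissipation μ D u x = 0) (i j : Fin 2) :
    partialWithin D u x i j + partialWithin D u x j i = 0 := by
  rw [dissipation, mul_eq_zero_iff_left (by simpa using hμ), Finset.sum_eq_zero_iff_of_nonneg
    fun _ _ => Finset.sum_nonneg fun _ _ => sq_nonneg _] at hx
  have hi := (Finset.sum_eq_zero_iff_of_nonneg fun _ _ => sq_nonneg _).1 (hx i (Finset.mem_univ i))
  exact sq_eq_zero_iff.1 (hi j (Finset.mem_univ j))

lemma sum_stress_mul_partialWithin {μ : ℝ} {D : Set Plane} {u : Plane → Plane} (p : Plane → ℝ)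
    {x : Plane} (hdiv : ∑ i, partialWithin D u x i i = 0) :
    ∑ i, ∑ j, stress μ D u p x i j * partialWithin D u x j i = dissipation μ D u x := by
  simp only [stress_apply, dissipation, Fin.sum_univ_two, if_true, zero_ne_one, one_ne_zero,
    if_false] at hdiv ⊢
  linear_combination (-p x) * hdiv

namespace IsMobilitySolution

open Suspension

variable {N : ℕ} {S : Suspension N} {μ : ℝ} {u₀ u : Plane → Plane} {p : Plane → ℝ}
  {v : Fin N → Plane} {ω : Fin N → ℝ}

lemma contDiffOn_power (h : IsMobilitySolution S μ u₀ u p v ω) :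
    ContDiffOn ℝ 1 (power μ S.closedFluid u p) S.fluid := by
  refine fun x hx => (contDiffAt_euclidean.2 fun i => ?_).contDiffWithinAt
  have hvel (j : Fin 2) : ContDiffAt ℝ 1 (fun y => u y j) x :=
    contDiffAt_euclidean.1 ((h.contDiffAt_velocity hx).of_le one_le_two) j
  simp only [power_apply]
  exact ContDiffAt.sum fun j _ => (h.contDiffAt_stress hx i j).mul (hvel j)

lemma fderiv_power (h : IsMobilitySolution S μ u₀ u p v ω) {x : Plane} (hx : x ∈ S.fluid)
    (i k : Fin 2) : fderiv ℝ (fun y => power μ S.closedFluid u p y i) x (unitVec k) =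
      ∑ j, (stress μ S.closedFluid u p x i j * partialWithin S.closedFluid u x j k +
        u x j * fderiv ℝ (fun y => stress μ S.closedFluid u p y i j) x (unitVec k)) := by
  have hvel (j : Fin 2) : HasFDerivAt (fun y => u y j)
      ((EuclideanSpace.proj j : Plane →L[ℝ] ℝ).comp (fderiv ℝ u x)) x :=
    (EuclideanSpace.proj j : Plane →L[ℝ] ℝ).hasFDerivAt.comp x
      ((h.contDiffAt_velocity hx).differentiableAt two_ne_zero).hasFDerivAt
  have hstress (j : Fin 2) :=
    ((h.contDiffAt_stress hx i j).differentiableAt one_ne_zero).hasFDerivAt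
  simp only [power_apply]
  rw [(HasFDerivAt.fun_sum fun j _ => (hstress j).fun_mul (hvel j)).fderiv]
  simp [partialWithin, fderivWithin_eq_fderiv hx]

theorem divergence_power (h : IsMobilitySolution S μ u₀ u p v ω) {x : Plane} (hx : x ∈ S.fluid) :
    divergence (power μ S.closedFluid u p) x = dissipation μ S.closedFluid u x := by
  have hdiff := (h.contDiffOn_power.contDiffAt (isOpen_fluid.mem_nhds hx)).differentiableAt
    one_ne_zero
  have hmomentum : ∑ i, ∑ j,
      u x j * fderiv ℝ (fun y => stress μ S.closedFluid u p y i j) x (unitVec i) = 0 := by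
    rw [Finset.sum_comm]
    simp only [← Finset.mul_sum, h.sum_fderiv_stress_eq_zero hx, mul_zero, Finset.sum_const_zero]
  simp only [divergence_eq_sum_fderiv_coord hdiff, h.fderiv_power hx, Finset.sum_add_distrib,
    hmomentum, add_zero, sum_stress_mul_partialWithin p (h.sum_partialWithin_eq_zero hx)]

lemma continuousOn_fderivWithin (h : IsMobilitySolution S μ u₀ u p v ω) :
    ContinuousOn (fderivWithin ℝ u S.closedFluid) S.closedFluid :=
  h.contDiffOn_velocity_closed.continuousOn_fderivWithin uniqueDiffOn_closedFluid le_rfl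

lemma continuousOn_stress (h : IsMobilitySolution S μ u₀ u p v ω) (i j : Fin 2) :
    ContinuousOn (fun x => stress μ S.closedFluid u p x i j) S.closedFluid := by
  have hgrad := h.continuousOn_fderivWithin
  have hpress := h.continuousOn_pressure_closed
  simp only [stress_apply, partialWithin]
  split_ifs <;> fun_prop

lemma continuousOn_traction (h : IsMobilitySolution S μ u₀ u p v ω) {X : Type*}
    [TopologicalSpace X] {s : Set X} {f n : X → Plane} (hf : ContinuousOn f s)
    (hn : ContinuousOn n s) (hs : MapsTo f s S.closedFluid) :
    ContinuousOn (fun y => traction μ S.closedFluid u p (f y) (n y)) s := by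
  have hstress i j : ContinuousOn (fun y => stress μ S.closedFluid u p (f y) i j) s :=
    (h.continuousOn_stress i j).comp hf hs
  refine (PiLp.continuous_toLp 2 _).comp_continuousOn (continuousOn_pi.2 fun i => ?_)
  simp only [Matrix.mulVec, dotProduct]
  fun_prop

lemma continuousOn_power (h : IsMobilitySolution S μ u₀ u p v ω) :
    ContinuousOn (power μ S.closedFluid u p) S.closedFluid :=
  h.continuousOn_traction continuousOn_id h.contDiffOn_velocity_closed.continuousOn (mapsTo_id _)

lemma continuous_boundaryTraction (h : IsMobilitySolution S μ u₀ u p v ω) (i : Fin N) :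
    Continuous (S.boundaryTraction μ u p i) :=
  continuousOn_univ.1 <| h.continuousOn_traction (S.object i).contDiff_curve.continuous.continuousOn
    SmoothObject.continuous_outwardNormal.continuousOn fun t _ => curve_mem_closedFluid i t

lemma power_add (h : IsMobilitySolution S μ u₀ u p v ω) :
    ∀ x ∈ S.closedFluid, ∀ ℓ : S.lattice,
      power μ S.closedFluid u p (x + ℓ) = power μ S.closedFluid u p x := fun x hx ℓ => by
  ext i
  simp only [power_apply, stress_apply, partialWithin, h.velocity_add x hx, h.pressure_add x hx,
    fderivWithin_add_lattice h.velocity_add hx]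

theorem flux_power (h : IsMobilitySolution S μ (fun _ => 0) u p v ω) (i : Fin N) :
    (S.object i).flux (power μ S.closedFluid u p) = 0 := by
  set B := S.object i
  set T := S.boundaryTraction μ u p i
  set lever := fun t => perp (B.curve t - B.centroid)
  have hT : Continuous T := h.continuous_boundaryTraction i
  have hlever : Continuous lever :=
    perpCLM.continuous.comp (B.contDiff_curve.continuous.sub continuous_const)
  have hpower t : inner ℝ (power μ S.closedFluid u p (B.curve t)) (B.outwardNormal t) =
      innerSL ℝ (v i) (T t) + (ω i • ContinuousLinearMap.id ℝ ℝ) (inner ℝ (T t) (lever t)) := by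
    have hrigid : u (B.curve t) = v i + ω i • lever t := by
      simpa using h.rigid i (B.curve t) (B.curve_mem_frontier t)
    calc inner ℝ (power μ S.closedFluid u p (B.curve t)) (B.outwardNormal t)
        = inner ℝ (u (B.curve t)) (T t) := inner_traction _ _ _ _ _ _ _
      _ = inner ℝ (v i) (T t) + ω i * inner ℝ (T t) (lever t) := by
        rw [hrigid, inner_add_left, real_inner_smul_left, real_inner_comm (lever t)]
  simp only [SmoothObject.flux, hpower]
  rw [SmoothObject.boundaryIntegral_add (by fun_prop) (by fun_prop),
    SmoothObject.boundaryIntegral_clm_apply _ hT,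
    SmoothObject.boundaryIntegral_clm_apply _ (hT.inner hlever), h.force_free i, h.torque_free i,
    map_zero, map_zero, add_zero]

theorem dissipation_eq_zero (h : IsMobilitySolution S μ (fun _ => 0) u p v ω) (hμ : 0 ≤ μ)
    {x : Plane} (hx : x ∈ S.fluid) : dissipation μ S.closedFluid u x = 0 := by
  rw [← h.divergence_power hx]
  refine divergence_eq_zero_of_flux_nonneg h.contDiffOn_power h.continuousOn_power h.power_add
    (fun y hy => ?_) (Finset.sum_nonneg fun i _ => (h.flux_power i).ge) hx
  rw [h.divergence_power hy]
  exact dissipation_nonneg hμ _ _ _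

lemma inner_fderiv_add_eq_zero (h : IsMobilitySolution S μ (fun _ => 0) u p v ω) (hμ : 0 < μ)
    {x : Plane} (hx : x ∈ S.fluid) (a b : Plane) :
    inner ℝ (fderiv ℝ u x a) b + inner ℝ (fderiv ℝ u x b) a = 0 := by
  have hstrain := partialWithin_add_eq_zero_of_dissipation_eq_zero hμ.ne'
    (h.dissipation_eq_zero hμ.le hx)
  simp only [partialWithin, fderivWithin_eq_fderiv hx] at hstrain
  rw [eq_sum_unitVec a, eq_sum_unitVec b]
  simp only [map_add, map_smul, inner_eq, PiLp.add_apply, PiLp.smul_apply, smul_eq_mul,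
    PiLp.single_eq_same, mul_one, ne_eq, zero_ne_one, not_false_eq_true, PiLp.single_eq_of_ne,
    mul_zero, add_zero, one_ne_zero, zero_add]
  linear_combination (a 0 * b 0) * hstrain 0 0 + (a 0 * b 1 + a 1 * b 0) * hstrain 0 1 +
    (a 1 * b 1) * hstrain 1 1

lemma fderiv_fderiv_velocity_eq_zero (h : IsMobilitySolution S μ (fun _ => 0) u p v ω) (hμ : 0 < μ)
    {x : Plane} (hx : x ∈ S.fluid) : fderiv ℝ (fderiv ℝ u) x = 0 :=
  fderiv_fderiv_eq_zero_of_skew (h.contDiffAt_velocity hx) <|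
    eventually_of_mem (isOpen_fluid.mem_nhds hx) fun _ => h.inner_fderiv_add_eq_zero hμ

lemma fderiv_pressure_eq_zero (h : IsMobilitySolution S μ (fun _ => 0) u p v ω) (hμ : 0 < μ)
    {x : Plane} (hx : x ∈ S.fluid) : fderiv ℝ p x = 0 := by
  ext a
  rw [eq_sum_unitVec a]
  simp [h.fderiv_pressure hx, h.fderiv_fderiv_velocity_eq_zero hμ hx]

lemma fderivWithin_velocity_eq (h : IsMobilitySolution S μ (fun _ => 0) u p v ω) (hμ : 0 < μ)
    {x y : Plane} (hx : x ∈ S.closedFluid) (hy : y ∈ S.closedFluid) :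
    fderivWithin ℝ u S.closedFluid x = fderivWithin ℝ u S.closedFluid y := by
  refine eq_of_fderiv_eq_zero (fun z hz => ?_) h.continuousOn_fderivWithin (fun z hz => ?_) hx hy
  · exact ((h.contDiffAt_fderivWithin hz).differentiableAt one_ne_zero).differentiableWithinAt
  · rw [(fderivWithin_eventuallyEq hz).fderiv_eq, h.fderiv_fderiv_velocity_eq_zero hμ hz]

lemma velocity_eq_affine (h : IsMobilitySolution S μ (fun _ => 0) u p v ω) (hμ : 0 < μ)
    {x y : Plane} (hx : x ∈ S.closedFluid) (hy : y ∈ S.closedFluid) :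
    u y = u x + fderivWithin ℝ u S.closedFluid x (y - x) := by
  set L := fderivWithin ℝ u S.closedFluid x with hL
  have hderiv {z : Plane} (hz : z ∈ S.fluid) : HasFDerivAt (𝕜 := ℝ) (fun z => u z - L z) 0 z := by
    have hu : HasFDerivAt u L z := by
      rw [hL, h.fderivWithin_velocity_eq hμ hx (fluid_subset_closedFluid hz),
        fderivWithin_eq_fderiv hz]
      exact ((h.contDiffAt_velocity hz).differentiableAt two_ne_zero).hasFDerivAt
    simpa using hu.fun_sub L.hasFDerivAt
  have hconst : u y - L y = u x - L x :=
    eq_of_fderiv_eq_zero (fun z hz => (hderiv hz).differentiableAt.differentiableWithinAt)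
      (h.contDiffOn_velocity_closed.continuousOn.sub L.continuous.continuousOn)
      (fun z hz => (hderiv hz).fderiv) hy hx
  rw [map_sub, sub_eq_iff_eq_add.1 hconst]
  abel

lemma fderivWithin_velocity_eq_zero (h : IsMobilitySolution S μ (fun _ => 0) u p v ω) (hμ : 0 < μ)
    {x : Plane} (hx : x ∈ S.closedFluid) : fderivWithin ℝ u S.closedFluid x = 0 := by
  refine ContinuousLinearMap.coe_injective (S.basis.ext fun i => ?_)
  let ℓ : S.lattice := ⟨S.basis i, Submodule.subset_span (mem_range_self i)⟩
  have haffine := h.velocity_eq_affine hμ hx ((add_mem_closedFluid ℓ).2 hx)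
  rw [h.velocity_add x hx, add_sub_cancel_left, left_eq_add] at haffine
  exact haffine

theorem velocity_eq (h : IsMobilitySolution S μ (fun _ => 0) u p v ω) (hμ : 0 < μ)
    {x y : Plane} (hx : x ∈ S.closedFluid) (hy : y ∈ S.closedFluid) : u x = u y := by
  rw [h.velocity_eq_affine hμ hy hx, h.fderivWithin_velocity_eq_zero hμ hy]
  simp

theorem pressure_eq (h : IsMobilitySolution S μ (fun _ => 0) u p v ω) (hμ : 0 < μ)
    {x y : Plane} (hx : x ∈ S.closedFluid) (hy : y ∈ S.closedFluid) : p x = p y :=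
  eq_of_fderiv_eq_zero (h.contDiffOn_pressure.differentiableOn one_ne_zero)
    h.continuousOn_pressure_closed (fun _ => h.fderiv_pressure_eq_zero hμ) hx hy

end IsMobilitySolution

end PeriodicMobility

end

theorem lemmal {N : ℕ} (S : PeriodicMobility.Suspension N) (μ : ℝ) (hμ : 0 < μ)
    (u : PeriodicMobility.Plane → PeriodicMobility.Plane) (p : PeriodicMobility.Plane → ℝ)
    (v : Fin N → PeriodicMobility.Plane) (ω : Fin N → ℝ)
    (h : PeriodicMobility.IsMobilitySolution S μ (fun _ => 0) u p v ω) :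
    (∃ c : PeriodicMobility.Plane, ∀ x ∈ S.closedFluid, u x = c) ∧
      ∃ q : ℝ, ∀ x ∈ S.closedFluid, p x = q := by
  rcases S.closedFluid.eq_empty_or_nonempty with hempty | ⟨x₀, hx₀⟩
  · simp [hempty]
  · exact ⟨⟨u x₀, fun x hx => h.velocity_eq hμ hx hx₀⟩, p x₀, fun x hx => h.pressure_eq hμ hx hx₀⟩
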